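/- Let $\mathfrak g$ be a finite-dimensional semisimple Lie algebra with Cartan matrix $A=(a_{ij})_{i,j\in I}$ (an arbitrary Cartan matrix of finite type), let $I$ be totally ordered, and let $(d_i)_{i\in I}$ be relatively prime positive integers with $d_ia_{ij}=d_ja_{ji}$. Put $\langle i,j\rangle=d_ia_{ij}$ if $i<j$, $\langle i,i\rangle=d_i$, and $\langle i,j\rangle=0$ if $i>j$. Let $\mathbb K$ be an algebraically closed field of characteristic $0$ and let $r,s\in\mathbb K^\times$ be such that $rs^{-1}$ is not a root of unity (for example, $r,s$ algebraically independent over $\mathbb Q$). Put $r_i=r^{d_i}$, $s_i=s^{d_i}$, and for $v\in\mathbb K$ let $(n)_v=1+v+\dots+v^{n-1}$, $(n)_v^!=(1)_v\cdots(n)_v$, $\binom nk_v=\frac{(n)_v^!}{(k)_v^!(n-k)_v^!}$. The two-parameter Kashiwara algebra $B_{r,s}(\mathfrak g)$ is the unital associative $\mathbb K$-algebra with generators $e_i'',f_i,\omega_i^{\pm1},\omega_i'^{\pm1}$ $(i\in I)$ and the following defining relations, for all $i,j\in I$: - $\omega_i^{\pm1}\omega_i^{\mp1}=\omega_i'^{\pm1}\omega_i'^{\mp1}=1$,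 and $\omega_i\omega_j=\omega_j\omega_i$, $\omega_i'\omega_j'=\omega_j'\omega_i'$, $\omega_i\omega_j'=\omega_j'\omega_i$; - $\omega_ie_j''\omega_i^{-1}=r^{\langle j,i\rangle}s^{-\langle i,j\rangle}e_j''$ and $\omega_i'e_j''\omega_i'^{-1}=r^{-\langle i,j\rangle}s^{\langle j,i\rangle}e_j''$; - $\omega_if_j\omega_i^{-1}=r^{-\langle j,i\rangle}s^{\langle i,j\rangle}f_j$ and $\omega_i'f_j\omega_i'^{-1}=r^{\langle i,j\rangle}s^{-\langle j,i\rangle}f_j$; - $e_i''f_j=r^{\langle j,i\rangle}s^{-\langle i,j\rangle}f_je_i''+\delta_{ij}$; - for $i\ne j$, and both for $X=e''$ and for $X=f$, $$\sum_{k=0}^{1-a_{ij}}(-1)^k\binom{1-a_{ij}}{k}_{r_is_i^{-1}}(r_is_i^{-1})^{\frac{k(k-1)}2}r^{k\langle j,i\rangle}s^{-k\langle i,j\rangle}X_i^kX_jX_i^{1-a_{ij}-k}=0.$$ Let $B^-_{r,s}(\mathfrak g)$, $T$ and $B^+_{r,s}(\mathfrak g)$ be the unital subalgebras of $B_{r,s}(\mathfrak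 g)$ generated by the $f_i$, by the $\omega_i^{\pm1}$ and $\omega_i'^{\pm1}$, and by the $e_i''$ $(i\in I)$, respectively. Then the multiplication map $$B^-_{r,s}(\mathfrak g)\otimes_{\mathbb K}T\otimes_{\mathbb K}B^+_{r,s}(\mathfrak g)\longrightarrow B_{r,s}(\mathfrak g),\qquad u_1\otimes u_2\otimes u_3\mapsto u_1u_2u_3,$$ is an isomorphism of $\mathbb K$-vector spaces. -/

import Mathlib

open scoped TensorProduct

noncomputable section

namespace TwoParamKashiwara

/-- `A` is a Cartan matrix of finite type: diagonal entries `2`, off-diagonal entries nonpositive,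
and `D * A` is symmetric and positive definite for some diagonal matrix `D` with positive entries.
(In particular `A i j = 0 ↔ A j i = 0`.) -/
structure IsFiniteTypeCartan {I : Type*} [Fintype I] [DecidableEq I] (A : Matrix I I ℤ) :
    Prop where
  diag : ∀ i, A i i = 2
  offDiag : ∀ i j, i ≠ j → A i j ≤ 0
  posDef : ∃ D : I → ℝ, (∀ i, 0 < D i) ∧
    (Matrix.diagonal D * A.map (fun n : ℤ => (n : ℝ))).PosDef

/-- `d` is a family of relatively prime positive integers with `d i * A i j = d j * A j i`. -/
structure IsSymmetrizer {I : Type*} [Fintype I] (A : Matrix I I ℤ) (d : I → ℕ) : Prop where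
  pos : ∀ i, 0 < d i
  coprime : Finset.univ.gcd d = 1
  symm : ∀ i j, (d i : ℤ) * A i j = (d j : ℤ) * A j i

/-- The `v`-integer `(n)_v = 1 + v + ⋯ + v ^ (n - 1)`. -/
def vInt {K : Type*} [Field K] (v : K) (n : ℕ) : K := ∑ k ∈ Finset.range n, v ^ k

/-- The `v`-factorial `(1)_v (2)_v ⋯ (n)_v`, equal to `1` for `n = 0`. -/
def vFactorial {K : Type*} [Field K] (v : K) (n : ℕ) : K :=
  ∏ k ∈ Finset.range n, vInt v (k + 1)

/-- The `v`-binomial coefficient, for `k ≤ n`; it is used only where `v` is not a root of unity,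
so that the denominator does not vanish. -/
def vBinom {K : Type*} [Field K] (v : K) (n k : ℕ) : K :=
  vFactorial v n / (vFactorial v k * vFactorial v (n - k))

/-- The Euler form `⟨i, j⟩` on simple roots: `d i * a i j` if `i < j`, `d i` if `i = j`,
and `0` if `i > j`. -/
def euler {I : Type*} [LinearOrder I] (A : Matrix I I ℤ) (d : I → ℕ) (i j : I) : ℤ :=
  if i < j then (d i : ℤ) * A i j else if i = j then (d i : ℤ) else 0

/-- The scalar `r ^ ⟨j, i⟩ * s ^ (-⟨i, j⟩)`. -/
def chi {K I : Type*} [Field K] [LinearOrder I] (A : Matrix I I ℤ) (d : I → ℕ) (r s : K)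
    (i j : I) : K :=
  r ^ euler A d j i * s ^ (-euler A d i j)

/-- The scalar `r ^ (-⟨i, j⟩) * s ^ ⟨j, i⟩`. -/
def chi' {K I : Type*} [Field K] [LinearOrder I] (A : Matrix I I ℤ) (d : I → ℕ) (r s : K)
    (i j : I) : K :=
  r ^ (-euler A d i j) * s ^ euler A d j i

/-- The generators: `e i` is `e_i''`, `f i` is `f_i`, `w i` and `wInv i` are `ω_i` and `ω_i⁻¹`,
`w' i` and `w'Inv i` are `ω_i'` and `ω_i'⁻¹`. -/
inductive Gen (I : Type*) where
  | e (i : I)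
  | f (i : I)
  | w (i : I)
  | wInv (i : I)
  | w' (i : I)
  | w'Inv (i : I)

/-- A generator as an element of the free algebra. -/
abbrev gen (K : Type*) [Field K] {I : Type*} (g : Gen I) : FreeAlgebra K (Gen I) :=
  FreeAlgebra.ι K g

/-- The Serre expression
`∑_{k = 0}^{1 - a i j} (-1)^k [1 - a i j choose k]_{v} c_k X^k Y X^(1 - a i j - k)`
with `v = r_i / s_i`, `r_i = r ^ d i`, `s_i = s ^ d i` and
`c_k = v ^ (k (k - 1) / 2) * r ^ (k ⟨j, i⟩) * s ^ (-k ⟨i, j⟩)`.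
For `i ≠ j` the integer `1 - a i j` is positive. -/
def serre {K I : Type*} [Field K] [LinearOrder I] (A : Matrix I I ℤ) (d : I → ℕ) (r s : K)
    (i j : I) (X Y : FreeAlgebra K (Gen I)) : FreeAlgebra K (Gen I) :=
  ∑ k ∈ Finset.range ((1 - A i j).toNat + 1),
    ((-1) ^ k * vBinom (r ^ d i * (s ^ d i)⁻¹) (1 - A i j).toNat k
        * ((r ^ d i * (s ^ d i)⁻¹) ^ (k * (k - 1) / 2)
          * r ^ ((k : ℤ) * euler A d j i) * s ^ (-(k : ℤ) * euler A d i j))) •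
      (X ^ k * Y * X ^ ((1 - A i j).toNat - k))

/-- The defining relations of the two-parameter Kashiwara algebra. -/
inductive Rel {K I : Type*} [Field K] [LinearOrder I] (A : Matrix I I ℤ) (d : I → ℕ) (r s : K) :
    FreeAlgebra K (Gen I) → FreeAlgebra K (Gen I) → Prop where
  | w_mul_inv (i : I) : Rel A d r s (gen K (.w i) * gen K (.wInv i)) 1
  | inv_mul_w (i : I) : Rel A d r s (gen K (.wInv i) * gen K (.w i)) 1
  | w'_mul_inv (i : I) : Rel A d r s (gen K (.w' i) * gen K (.w'Inv i)) 1
  | inv_mul_w' (i : I) : Rel A d r s (gen K (.w'Inv i) * gen K (.w' i)) 1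
  | w_comm (i j : I) : Rel A d r s (gen K (.w i) * gen K (.w j)) (gen K (.w j) * gen K (.w i))
  | w'_comm (i j : I) :
      Rel A d r s (gen K (.w' i) * gen K (.w' j)) (gen K (.w' j) * gen K (.w' i))
  | w_w'_comm (i j : I) :
      Rel A d r s (gen K (.w i) * gen K (.w' j)) (gen K (.w' j) * gen K (.w i))
  | w_e (i j : I) :
      Rel A d r s (gen K (.w i) * gen K (.e j) * gen K (.wInv i))
        (chi A d r s i j • gen K (.e j))
  | w'_e (i j : I) :
      Rel A d r s (gen K (.w' i) * gen K (.e j) * gen K (.w'Inv i))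
        (chi' A d r s i j • gen K (.e j))
  | w_f (i j : I) :
      Rel A d r s (gen K (.w i) * gen K (.f j) * gen K (.wInv i))
        ((r ^ (-euler A d j i) * s ^ euler A d i j) • gen K (.f j))
  | w'_f (i j : I) :
      Rel A d r s (gen K (.w' i) * gen K (.f j) * gen K (.w'Inv i))
        ((r ^ euler A d i j * s ^ (-euler A d j i)) • gen K (.f j))
  | e_f (i j : I) :
      Rel A d r s (gen K (.e i) * gen K (.f j))
        (chi A d r s i j • (gen K (.f j) * gen K (.e i)) + if i = j then 1 else 0)
  | serre_e (i j : I) (h : i ≠ j) :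
      Rel A d r s (serre A d r s i j (gen K (.e i)) (gen K (.e j))) 0
  | serre_f (i j : I) (h : i ≠ j) :
      Rel A d r s (serre A d r s i j (gen K (.f i)) (gen K (.f j))) 0

/-- The two-parameter Kashiwara algebra `B_{r,s}(𝔤)`: the unital associative `K`-algebra with the
generators `Gen I` and the defining relations `Rel A d r s`. -/
abbrev Kashiwara {K I : Type*} [Field K] [LinearOrder I] (A : Matrix I I ℤ) (d : I → ℕ)
    (r s : K) : Type _ :=
  RingQuot (Rel A d r s)

/-- The image of a generator in the two-parameter Kashiwara algebra. -/
def mkGen {K I : Type*} [Field K] [LinearOrder I] (A : Matrix I I ℤ) (d : I → ℕ)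
    (r s : K) (g : Gen I) : Kashiwara A d r s :=
  RingQuot.mkAlgHom K (Rel A d r s) (gen K g)

/-- `B^-_{r,s}(𝔤)`, the unital subalgebra generated by the `f_i`. -/
def Bminus {K I : Type*} [Field K] [LinearOrder I] (A : Matrix I I ℤ) (d : I → ℕ) (r s : K) :
    Subalgebra K (Kashiwara A d r s) :=
  Algebra.adjoin K {x | ∃ i : I, x = mkGen A d r s (.f i)}

/-- `T`, the unital subalgebra generated by the `ω_i^{±1}` and the `ω_i'^{±1}`. -/
def T {K I : Type*} [Field K] [LinearOrder I] (A : Matrix I I ℤ) (d : I → ℕ) (r s : K) :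
    Subalgebra K (Kashiwara A d r s) :=
  Algebra.adjoin K {x | ∃ i : I, x = mkGen A d r s (.w i) ∨ x = mkGen A d r s (.wInv i) ∨
    x = mkGen A d r s (.w' i) ∨ x = mkGen A d r s (.w'Inv i)}

/-- `B^+_{r,s}(𝔤)`, the unital subalgebra generated by the `e_i''`. -/
def Bplus {K I : Type*} [Field K] [LinearOrder I] (A : Matrix I I ℤ) (d : I → ℕ) (r s : K) :
    Subalgebra K (Kashiwara A d r s) :=
  Algebra.adjoin K {x | ∃ i : I, x = mkGen A d r s (.e i)}

end TwoParamKashiwara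

end

/-! The difficulty is independence: the cross relations let every product be reordered as `f`-part,
torus part, `e`-part, but a priori the relations could force collapses. The remedy is a concrete
module in which nothing collapses.

Let `Half` be the algebra presented by the Serre relations alone and `Torus` the group algebra of a
free abelian group, here on `I ⊕ I`. On `Verma`, the space `Half ⊗ Torus ⊗ Half`, every generator
acts by the formula that normal ordering would dictate: `f i` by left multiplication, torus elements
by rescaling and multiplication, `e i` by a skew derivation of the left factor plus a twisted left
multiplication on the other two. Once these operators satisfy the defining relations (`rep`),
applying the image of `v` under `triMul` to the cyclic vector `1 ⊗ 1 ⊗ 1` returns `v`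
(`rep_triMul`), so `triMul` is injective. Its range contains `1` and is stable under left
multiplication by the generators, so it is surjective. Since `triMul` factors through a surjection
onto the tensor product of the three subalgebras, their multiplication map is bijective as well.

The Serre relations enter in two ways. The skew derivations must descend to `Half` (`derivMatrix`),
and the operators `opE` must satisfy the Serre relations (`serrePoly_opE`). Both reduce to facts
about the polynomial whose coefficients are those of the Serre expression: a recursion that makes
sums telescope, and two explicit roots. -/

noncomputable section

namespace TwoParamKashiwara

/-! ### Identities for `v`-binomials and for Serre polynomials under skew commutation. -/

section QIdentities

variable {K : Type*} [Field K] {R : Type*} [Ring R] [Algebra K R]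

lemma vInt_zero (v : K) : vInt v 0 = 0 := by simp [vInt]

lemma vInt_succ (v : K) (n : ℕ) : vInt v (n + 1) = v ^ n + vInt v n := by
  rw [vInt, Finset.sum_range_succ, add_comm]; rfl

lemma vInt_mul_sub_one (v : K) (n : ℕ) : vInt v n * (v - 1) = v ^ n - 1 :=
  geom_sum_mul v n

lemma vInt_ne_zero {v : K} (hv : ∀ n : ℕ, 0 < n → v ^ n ≠ 1) {n : ℕ} (hn : 0 < n) :
    vInt v n ≠ 0 := fun h => by
  have := vInt_mul_sub_one v n
  rw [h, zero_mul] at this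
  exact hv n hn (sub_eq_zero.1 this.symm)

lemma vFactorial_ne_zero {v : K} (hv : ∀ n : ℕ, 0 < n → v ^ n ≠ 1) (n : ℕ) :
    vFactorial v n ≠ 0 :=
  Finset.prod_ne_zero_iff.2 fun k _ => vInt_ne_zero hv k.succ_pos

lemma vFactorial_succ (v : K) (n : ℕ) :
    vFactorial v (n + 1) = vFactorial v n * vInt v (n + 1) := by
  rw [vFactorial, Finset.prod_range_succ]; rfl

lemma vBinom_succ_mul {v : K} (hv : ∀ n : ℕ, 0 < n → v ^ n ≠ 1) {n k : ℕ} (hk : k < n) :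
    vBinom v n (k + 1) * vInt v (k + 1) = vBinom v n k * vInt v (n - k) := by
  obtain ⟨m, rfl⟩ := Nat.exists_eq_add_of_lt hk
  have h1 : k + m + 1 - (k + 1) = m := by omega
  have h2 : k + m + 1 - k = m + 1 := by omega
  rw [vBinom, vBinom, h1, h2, vFactorial_succ v k, vFactorial_succ v m]
  have := vFactorial_ne_zero hv k
  have := vFactorial_ne_zero hv m
  have := vInt_ne_zero hv k.succ_pos
  have := vInt_ne_zero hv m.succ_pos
  field_simp

/-- A coefficient sequence with the recursion of `(-1)^k [N choose k]_v v^(k(k-1)/2) c^k`. -/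
def IsSerreCoeff (v c : K) (N : ℕ) (q : ℕ → K) : Prop :=
  ∀ k < N, q (k + 1) * vInt v (k + 1) = -(q k * v ^ k * c * vInt v (N - k))

lemma isSerreCoeff_vBinom {v : K} (hv : ∀ n : ℕ, 0 < n → v ^ n ≠ 1) (c : K) (N : ℕ) :
    IsSerreCoeff v c N
      (fun k => (-1) ^ k * vBinom v N k * (v ^ (k * (k - 1) / 2) * c ^ k)) := by
  intro k hk
  have h : (k + 1) * (k + 1 - 1) / 2 = k * (k - 1) / 2 + k := by
    rw [← Nat.choose_two_right, ← Nat.choose_two_right, Nat.choose_succ_succ' k 1]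
    simp [add_comm]
  have := vBinom_succ_mul hv hk
  simp only [h, pow_add, pow_one]
  linear_combination ((-1) ^ k * (-1) * v ^ (k * (k - 1) / 2) * v ^ k * c ^ k * c) * this

/-- This is the `v`-binomial theorem in difference form: up to the factor `q 0`, the polynomial
`P(z) = ∑ q k z^k` should be `∏ (1 - c v^l z)` over `l < N`, and the identity compares `P(vz)` with
`P(z)`. It follows by multiplying the recursion by `z^(k+1)`, summing, and using `vInt v n * (v - 1)
= v^n - 1`. -/
lemma IsSerreCoeff.functional_equation {v c : K} {N : ℕ} {q : ℕ → K}
    (hq : IsSerreCoeff v c N q) (z : K) :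
    (∑ k ∈ Finset.range (N + 1), q k * (v * z) ^ k) * (1 - c * z) =
      (∑ k ∈ Finset.range (N + 1), q k * z ^ k) * (1 - c * z * v ^ N) := by
  have key : ∑ k ∈ Finset.range (N + 1), q k * vInt v k * z ^ k =
      -∑ k ∈ Finset.range (N + 1), q k * v ^ k * c * vInt v (N - k) * z ^ (k + 1) := by
    rw [Finset.sum_range_succ', Finset.sum_range_succ, vInt_zero, Nat.sub_self, vInt_zero]
    simp only [mul_zero, zero_mul, add_zero]
    rw [← Finset.sum_neg_distrib]
    refine Finset.sum_congr rfl fun k hk => ?_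
    rw [hq k (Finset.mem_range.1 hk)]; ring
  have h1 : ∑ k ∈ Finset.range (N + 1), q k * (v * z) ^ k
      - ∑ k ∈ Finset.range (N + 1), q k * z ^ k =
      (∑ k ∈ Finset.range (N + 1), q k * vInt v k * z ^ k) * (v - 1) := by
    rw [← Finset.sum_sub_distrib, Finset.sum_mul]
    refine Finset.sum_congr rfl fun k _ => ?_
    have := vInt_mul_sub_one v k
    rw [mul_pow]
    linear_combination (- q k * z ^ k) * this
  have h2 : (∑ k ∈ Finset.range (N + 1), q k * v ^ k * c * vInt v (N - k) * z ^ (k + 1))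
      * (v - 1) = c * z * (v ^ N * (∑ k ∈ Finset.range (N + 1), q k * z ^ k) -
        ∑ k ∈ Finset.range (N + 1), q k * (v * z) ^ k) := by
    rw [Finset.mul_sum, ← Finset.sum_sub_distrib, Finset.sum_mul, Finset.mul_sum]
    refine Finset.sum_congr rfl fun k hk => ?_
    have := vInt_mul_sub_one v (N - k)
    have hN : v ^ N = v ^ k * v ^ (N - k) := by
      rw [← pow_add]; congr 1; have := Finset.mem_range.1 hk; omega
    rw [mul_pow, hN]
    linear_combination (q k * v ^ k * c * z ^ (k + 1)) * this
  rw [key] at h1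
  linear_combination h1 - h2

/-- The root of the factor `l = 0`: the functional equation at `z` reads `0 = P(z) (1 - v^N)`. -/
lemma IsSerreCoeff.sum_eq_zero_of_mul_eq_one {v c : K} (hv : ∀ n : ℕ, 0 < n → v ^ n ≠ 1)
    {N : ℕ} (hN : 0 < N) {q : ℕ → K} (hq : IsSerreCoeff v c N q) {z : K} (hz : c * z = 1) :
    ∑ k ∈ Finset.range (N + 1), q k * z ^ k = 0 := by
  have h := hq.functional_equation z
  rw [hz, sub_self, mul_zero, one_mul] at h
  exact (mul_eq_zero.1 h.symm).resolve_right (sub_ne_zero.2 (hv N hN).symm)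

/-- The root of the factor `l = N - 1`: at `z / v` the right side of the functional equation
vanishes, and the remaining factor `1 - c z / v` is nonzero because `c z / v` is the inverse of
`v^N`. -/
lemma IsSerreCoeff.sum_eq_zero_of_mul_eq_pow {v c : K} (hv : ∀ n : ℕ, 0 < n → v ^ n ≠ 1)
    (hv0 : v ≠ 0) {N : ℕ} (hN : 0 < N) {q : ℕ → K} (hq : IsSerreCoeff v c N q) {z : K}
    (hz : c * z * v ^ N = v) :
    ∑ k ∈ Finset.range (N + 1), q k * z ^ k = 0 := by
  have h := hq.functional_equation (z / v)
  rw [mul_div_cancel₀ _ hv0, show c * (z / v) * v ^ N = 1 by field_simp; linear_combination hz,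
    sub_self, mul_zero] at h
  refine (mul_eq_zero.1 h).resolve_right (sub_ne_zero.2 fun h' => hv N hN ?_)
  have : c * (z / v) * v ^ N = 1 := by field_simp; linear_combination hz
  rwa [← h', one_mul] at this

/-- The noncommutative polynomial `∑ k, q k x^k y x^(N-k)`. -/
def serreSum (q : ℕ → K) (N : ℕ) (x y : R) : R :=
  ∑ k ∈ Finset.range (N + 1), q k • (x ^ k * y * x ^ (N - k))

lemma map_serreSum {S : Type*} [Ring S] [Algebra K S] (φ : R →ₐ[K] S) (q : ℕ → K) (N : ℕ)
    (x y : R) : φ (serreSum q N x y) = serreSum q N (φ x) (φ y) := by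
  simp [serreSum]

lemma serreSum_smul (q : ℕ → K) (N : ℕ) (a b : K) (x y : R) :
    serreSum q N (a • x) (b • y) = (a ^ N * b) • serreSum q N x y := by
  rw [serreSum, serreSum, Finset.smul_sum]
  refine Finset.sum_congr rfl fun k hk => ?_
  have hN : a ^ N = a ^ k * a ^ (N - k) := by
    rw [← pow_add]; congr 1; have := Finset.mem_range.1 hk; omega
  simp only [smul_pow, smul_mul_assoc, mul_smul_comm, smul_smul, hN]
  congr 1; ring

/-- The `β`-part of term `k + 1` cancels the `γ`-part of term `k`. The truncated exponents `0 - 1`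
and `N - N - 1` occur only with the vanishing coefficients `β 0` and `γ N`. -/
lemma sum_telescope_eq_zero {q β γ : ℕ → K} {N : ℕ} (h0 : β 0 = 0) (hN : γ N = 0)
    (h : ∀ k < N, q (k + 1) * β (k + 1) = -(q k * γ k)) (x y : R) :
    ∑ k ∈ Finset.range (N + 1), q k • (β k • (x ^ (k - 1) * y * x ^ (N - k)) +
      γ k • (x ^ k * y * x ^ (N - k - 1))) = 0 := by
  simp only [smul_add, smul_smul, Finset.sum_add_distrib]
  rw [Finset.sum_range_succ', Finset.sum_range_succ _ N, h0, hN]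
  simp only [mul_zero, zero_smul, add_zero]
  rw [← Finset.sum_add_distrib]
  refine Finset.sum_eq_zero fun k hk => ?_
  rw [h k (Finset.mem_range.1 hk), Nat.add_sub_cancel, Nat.sub_sub, neg_smul, neg_add_cancel]

/-- For `m = 0` the truncated power `x ^ (0 - 1)` is harmless, since `vInt v 0 = 0`. -/
lemma pow_mul_of_skew_comm {v : K} {x F : R} (h : x * F = v • (F * x) + 1) (m : ℕ) :
    x ^ m * F = v ^ m • (F * x ^ m) + vInt v m • x ^ (m - 1) := by
  induction m with
  | zero => simp [vInt_zero]
  | succ m ih =>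
    rw [pow_succ', mul_assoc, ih, mul_add, mul_smul_comm, ← mul_assoc x F, h, vInt_succ,
      mul_smul_comm]
    rcases m with _ | m
    · simp [vInt_zero]
    · simp only [Nat.add_sub_cancel, ← pow_succ', add_mul, smul_add, smul_mul_assoc, smul_smul,
        one_mul, mul_assoc, ← pow_succ, add_smul]
      abel

lemma pow_mul_of_q_comm {a : K} {x F : R} (h : x * F = a • (F * x)) (m : ℕ) :
    x ^ m * F = a ^ m • (F * x ^ m) := by
  induction m with
  | zero => simp
  | succ m ih =>
    rw [pow_succ', mul_assoc, ih, mul_smul_comm, ← mul_assoc x F, h, smul_mul_assoc, smul_smul,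
      ← pow_succ, mul_assoc]

lemma serreSum_mul_of_q_comm {a b : K} {q : ℕ → K} {N : ℕ} {x y F : R}
    (hx : x * F = a • (F * x)) (hy : y * F = b • (F * y)) :
    serreSum q N x y * F = (a ^ N * b) • (F * serreSum q N x y) := by
  rw [serreSum, Finset.sum_mul, Finset.mul_sum, Finset.smul_sum]
  refine Finset.sum_congr rfl fun k hk => ?_
  have hN : a ^ N = a ^ k * a ^ (N - k) := by
    rw [← pow_add]; congr 1; have := Finset.mem_range.1 hk; omega
  rw [smul_mul_assoc, mul_assoc, pow_mul_of_q_comm hx, mul_smul_comm, ← mul_assoc _ F,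
    mul_assoc _ y, hy, mul_smul_comm, ← mul_assoc _ F, pow_mul_of_q_comm hx]
  simp only [smul_mul_assoc, mul_smul_comm, smul_smul, hN, mul_assoc]
  congr 1; ring

/-- The right skew derivation attached to `x` annihilates the Serre polynomial. -/
lemma serreSum_mul_of_skew_comm_left {v c c' : K} {q : ℕ → K} {N : ℕ} (hq : IsSerreCoeff v c N q)
    (hc : c * c' * v ^ N = v) (hv0 : v ≠ 0) {x y F : R}
    (hx : x * F = v • (F * x) + 1) (hy : y * F = c' • (F * y)) :
    serreSum q N x y * F = (v ^ N * c') • (F * serreSum q N x y) := by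
  -- Moving `F` to the left through `x^k y x^(N-k)` leaves one residue from each block of `x`'s.
  -- These residues telescope because `hc` amounts to `c c' v^(N-1) = 1`.
  have key : ∑ k ∈ Finset.range (N + 1), q k • ((v ^ (N - k) * c' * vInt v k) •
      (x ^ (k - 1) * y * x ^ (N - k)) + vInt v (N - k) • (x ^ k * y * x ^ (N - k - 1))) = 0 := by
    refine sum_telescope_eq_zero (β := fun k => v ^ (N - k) * c' * vInt v k)
      (γ := fun k => vInt v (N - k)) (by simp [vInt_zero]) (by simp [vInt_zero])
      (fun k hk => ?_) x y
    have h := hq k hk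
    have hN : v ^ N = v * (v ^ k * v ^ (N - (k + 1))) := by
      rw [← pow_add, ← pow_succ']; congr 1; omega
    have h1 : c * c' * (v ^ k * v ^ (N - (k + 1))) = 1 := by
      rw [hN] at hc
      exact mul_left_cancel₀ hv0 (by linear_combination hc)
    linear_combination (v ^ (N - (k + 1)) * c') * h - q k * vInt v (N - k) * h1
  rw [serreSum, Finset.sum_mul, Finset.mul_sum, Finset.smul_sum, ← sub_eq_zero,
    ← Finset.sum_sub_distrib, ← key]
  refine Finset.sum_congr rfl fun k hk => ?_
  have hN : v ^ N = v ^ k * v ^ (N - k) := by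
    rw [← pow_add]; congr 1; have := Finset.mem_range.1 hk; omega
  have hk' : x ^ k * y * x ^ (N - k) * F =
      (v ^ N * c') • (F * (x ^ k * y * x ^ (N - k))) +
      ((v ^ (N - k) * c' * vInt v k) • (x ^ (k - 1) * y * x ^ (N - k)) +
        vInt v (N - k) • (x ^ k * y * x ^ (N - k - 1))) := by
    rw [mul_assoc, pow_mul_of_skew_comm hx, mul_add, mul_smul_comm, ← mul_assoc _ F,
      mul_assoc _ y, hy, mul_smul_comm, ← mul_assoc _ F, pow_mul_of_skew_comm hx]
    simp only [smul_mul_assoc, mul_smul_comm, smul_smul, hN, mul_assoc, add_mul, smul_add,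
      add_assoc]
    congr 2
    ring
  rw [smul_mul_assoc, hk', mul_smul_comm, smul_add, smul_comm (q k) (v ^ N * c'),
    add_sub_cancel_left]

/-- The right skew derivation attached to `y` annihilates the Serre polynomial. -/
lemma serreSum_mul_of_skew_comm_right {v c b : K} (hv : ∀ n : ℕ, 0 < n → v ^ n ≠ 1) {q : ℕ → K}
    {N : ℕ} (hN : 0 < N) (hq : IsSerreCoeff v c N q) (hc : c ≠ 0) {x y F : R}
    (hx : x * F = c • (F * x)) (hy : y * F = b • (F * y) + 1) :
    serreSum q N x y * F = (c ^ N * b) • (F * serreSum q N x y) := by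
  -- Only `y` leaves a residue, namely `c^(N-k) x^N`. The total coefficient is `c^N P(c⁻¹)`, and
  -- `c⁻¹` is a root.
  have key := hq.sum_eq_zero_of_mul_eq_one hv hN (mul_inv_cancel₀ hc)
  have key' : ∑ k ∈ Finset.range (N + 1), (q k * c ^ (N - k)) • x ^ N = 0 := by
    rw [← Finset.sum_smul]
    have : ∑ k ∈ Finset.range (N + 1), (q k * c ^ (N - k)) =
        c ^ N * ∑ k ∈ Finset.range (N + 1), q k * c⁻¹ ^ k := by
      rw [Finset.mul_sum]
      refine Finset.sum_congr rfl fun k hk => ?_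
      have hN : c ^ N = c ^ k * c ^ (N - k) := by
        rw [← pow_add]; congr 1; have := Finset.mem_range.1 hk; omega
      rw [hN, inv_pow]
      field_simp
    rw [this, key, mul_zero, zero_smul]
  rw [serreSum, Finset.sum_mul, Finset.mul_sum, Finset.smul_sum, ← sub_eq_zero,
    ← Finset.sum_sub_distrib, ← key']
  refine Finset.sum_congr rfl fun k hk => ?_
  have hkN : k + (N - k) = N := by have := Finset.mem_range.1 hk; omega
  have hN : c ^ N = c ^ k * c ^ (N - k) := by rw [← pow_add, hkN]
  have hk' : x ^ k * y * x ^ (N - k) * F =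
      (c ^ N * b) • (F * (x ^ k * y * x ^ (N - k))) + c ^ (N - k) • x ^ N := by
    rw [mul_assoc, pow_mul_of_q_comm hx, mul_smul_comm, ← mul_assoc _ F,
      mul_assoc _ y, hy, mul_add, mul_smul_comm, ← mul_assoc _ F, pow_mul_of_q_comm hx, mul_one,
      add_mul, ← pow_add, hkN]
    simp only [smul_mul_assoc, smul_smul, hN, mul_assoc, smul_add]
    congr 2
    ring
  rw [smul_mul_assoc, hk', mul_smul_comm, smul_add, smul_comm (q k) (c ^ N * b),
    add_sub_cancel_left, smul_smul]

/-- The left skew derivation attached to `x` annihilates the Serre polynomial. -/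
lemma serreSum_matrix_left {v c : K} {q : ℕ → K} {N : ℕ} (hq : IsSerreCoeff v c N q) {x y : R}
    (h : serreSum q N x y = 0) :
    serreSum q N !![v • x, 1; 0, x] !![c • y, 0; 0, y] = 0 := by
  -- The corner of the `m`-th power is the skew derivative of `x^m`. In the corner of the Serre sum
  -- the recursion of `q` alone gives the cancellation.
  have hpow : ∀ m : ℕ, !![v • x, 1; 0, x] ^ m =
      !![v ^ m • x ^ m, vInt v m • x ^ (m - 1); 0, x ^ m] := by
    intro m
    induction m with
    | zero => simp [vInt_zero, Matrix.one_fin_two]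
    | succ m ih =>
      rw [pow_succ, ih, Matrix.mul_fin_two, vInt_succ]
      rcases m with _ | m
      · simp [vInt_zero]
      · simp [pow_succ, smul_smul, add_smul, mul_comm]
  have key := sum_telescope_eq_zero (q := q) (β := fun k => vInt v k)
      (γ := fun k => v ^ k * c * vInt v (N - k)) (N := N) (by simp [vInt_zero])
      (by simp [vInt_zero]) (fun k hk => by rw [hq k hk]; ring) x y
  have hterm : ∀ k ∈ Finset.range (N + 1), q k • (!![v • x, 1; 0, x] ^ k * !![c • y, 0; 0, y] *
      !![v • x, 1; 0, x] ^ (N - k)) =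
      !![(v ^ N * c) • (q k • (x ^ k * y * x ^ (N - k))),
        q k • (vInt v k • (x ^ (k - 1) * y * x ^ (N - k)) +
        (v ^ k * c * vInt v (N - k)) • (x ^ k * y * x ^ (N - k - 1)));
        0, q k • (x ^ k * y * x ^ (N - k))] := by
    intro k hk
    have hN : v ^ N = v ^ k * v ^ (N - k) := by
      rw [← pow_add]; congr 1; have := Finset.mem_range.1 hk; omega
    rw [hpow, hpow, Matrix.mul_fin_two, Matrix.mul_fin_two, Matrix.smul_of, hN]
    simp only [Matrix.smul_cons, Matrix.smul_empty, mul_zero, zero_mul, add_zero, zero_add,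
      smul_zero, smul_mul_assoc, mul_smul_comm, smul_smul, smul_add]
    rw [add_comm ((q k * _) • (x ^ k * y * _))]
    congr 4 <;> ring_nf
  rw [serreSum, Finset.sum_congr rfl hterm]
  rw [serreSum] at h
  ext a b
  rw [Matrix.sum_apply]
  fin_cases a <;> fin_cases b
  · simp [← Finset.smul_sum, h]
  · simpa using key
  · simp
  · simpa using h

lemma diagonal_pow_fin_two (c : K) (x : R) (m : ℕ) :
    !![c • x, 0; 0, x] ^ m = !![c ^ m • x ^ m, 0; 0, x ^ m] := by
  induction m with
  | zero => simp [Matrix.one_fin_two]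
  | succ m ih =>
    rw [pow_succ, ih, Matrix.mul_fin_two]
    simp [pow_succ, smul_smul, mul_comm]

/-- The left skew derivation attached to `y` annihilates the Serre polynomial. -/
lemma serreSum_matrix_right {c b : K} {q : ℕ → K} {N : ℕ}
    (hq : ∑ k ∈ Finset.range (N + 1), q k * c ^ k = 0) {x y : R} (h : serreSum q N x y = 0) :
    serreSum q N !![c • x, 0; 0, x] !![b • y, 1; 0, y] = 0 := by
  have hterm : ∀ k ∈ Finset.range (N + 1), q k • (!![c • x, 0; 0, x] ^ k * !![b • y, 1; 0, y] *
      !![c • x, 0; 0, x] ^ (N - k)) =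
      !![(c ^ N * b) • (q k • (x ^ k * y * x ^ (N - k))), (q k * c ^ k) • x ^ N;
        0, q k • (x ^ k * y * x ^ (N - k))] := by
    intro k hk
    have hkN : k + (N - k) = N := by have := Finset.mem_range.1 hk; omega
    have hN : c ^ N = c ^ k * c ^ (N - k) := by rw [← pow_add, hkN]
    have hx : x ^ N = x ^ k * x ^ (N - k) := by rw [← pow_add, hkN]
    rw [diagonal_pow_fin_two, diagonal_pow_fin_two, Matrix.mul_fin_two, Matrix.mul_fin_two,
      Matrix.smul_of, hN, hx]
    simp only [Matrix.smul_cons, Matrix.smul_empty, mul_zero, zero_mul, add_zero, zero_add,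
      smul_zero, smul_mul_assoc, mul_smul_comm, smul_smul, mul_one]
    congr 4; ring
  rw [serreSum, Finset.sum_congr rfl hterm]
  rw [serreSum] at h
  ext a b
  rw [Matrix.sum_apply]
  fin_cases a <;> fin_cases b
  · simp [← Finset.smul_sum, h]
  · simp [← Finset.sum_smul, hq]
  · simp
  · simpa using h

lemma serreSum_matrix_diagonal {a b : K} {q : ℕ → K} {N : ℕ} {x y : R}
    (h : serreSum q N x y = 0) :
    serreSum q N !![a • x, 0; 0, x] !![b • y, 0; 0, y] = 0 := by
  have hterm : ∀ k ∈ Finset.range (N + 1), q k • (!![a • x, 0; 0, x] ^ k * !![b • y, 0; 0, y] *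
      !![a • x, 0; 0, x] ^ (N - k)) =
      !![(a ^ N * b) • (q k • (x ^ k * y * x ^ (N - k))), 0;
        0, q k • (x ^ k * y * x ^ (N - k))] := by
    intro k hk
    have hN : a ^ N = a ^ k * a ^ (N - k) := by
      rw [← pow_add]; congr 1; have := Finset.mem_range.1 hk; omega
    rw [diagonal_pow_fin_two, diagonal_pow_fin_two, Matrix.mul_fin_two, Matrix.mul_fin_two,
      Matrix.smul_of, hN]
    simp only [Matrix.smul_cons, Matrix.smul_empty, mul_zero, zero_mul, add_zero, zero_add,
      smul_zero, smul_mul_assoc, mul_smul_comm, smul_smul]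
    congr 4; ring
  rw [serreSum, Finset.sum_congr rfl hterm]
  rw [serreSum] at h
  ext a b
  rw [Matrix.sum_apply]
  fin_cases a <;> fin_cases b
  · simp [← Finset.smul_sum, h]
  · simp
  · simp
  · simpa using h

end QIdentities

/-! ### The algebra of the Serre relations and its skew derivations. -/

section Halves

variable {K I : Type*} [Field K] [LinearOrder I]

/-- The coefficients of the Serre polynomial. -/
def serreCoeff (A : Matrix I I ℤ) (d : I → ℕ) (r s : K) (i j : I) (k : ℕ) : K :=
  (-1) ^ k * vBinom (r ^ d i * (s ^ d i)⁻¹) (1 - A i j).toNat k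
        * ((r ^ d i * (s ^ d i)⁻¹) ^ (k * (k - 1) / 2)
          * r ^ ((k : ℤ) * euler A d j i) * s ^ (-(k : ℤ) * euler A d i j))

/-- The Serre polynomial in an arbitrary algebra. -/
def serrePoly (A : Matrix I I ℤ) (d : I → ℕ) (r s : K) (i j : I) {R : Type*} [Ring R]
    [Algebra K R] (x y : R) : R :=
  serreSum (serreCoeff A d r s i j) (1 - A i j).toNat x y

lemma map_serrePoly (A : Matrix I I ℤ) (d : I → ℕ) (r s : K) (i j : I) {R S : Type*} [Ring R]
    [Algebra K R] [Ring S] [Algebra K S] (φ : R →ₐ[K] S) (x y : R) :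
    φ (serrePoly A d r s i j x y) = serrePoly A d r s i j (φ x) (φ y) :=
  map_serreSum _ _ _ _ _

section Scalars

variable {A : Matrix I I ℤ} {d : I → ℕ} {r s : K}

lemma chi_ne_zero (hr : r ≠ 0) (hs : s ≠ 0) (i j : I) : chi A d r s i j ≠ 0 :=
  mul_ne_zero (zpow_ne_zero _ hr) (zpow_ne_zero _ hs)

lemma chi'_ne_zero (hr : r ≠ 0) (hs : s ≠ 0) (i j : I) : chi' A d r s i j ≠ 0 :=
  mul_ne_zero (zpow_ne_zero _ hr) (zpow_ne_zero _ hs)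

lemma chi_self (i : I) : chi A d r s i i = r ^ d i * (s ^ d i)⁻¹ := by
  simp [chi, euler]

lemma serreCoeff_eq (i j : I) :
    serreCoeff A d r s i j = fun k => (-1) ^ k * vBinom (chi A d r s i i) (1 - A i j).toNat k
        * (chi A d r s i i ^ (k * (k - 1) / 2) * chi A d r s i j ^ k) := by
  funext k
  have h1 : r ^ ((k : ℤ) * euler A d j i) = (r ^ euler A d j i) ^ k := by
    rw [mul_comm, zpow_mul, zpow_natCast]
  have h2 : s ^ (-(k : ℤ) * euler A d i j) = (s ^ (-euler A d i j)) ^ k := by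
    rw [neg_mul_comm, mul_comm, zpow_mul, zpow_natCast]
  rw [serreCoeff, chi_self, chi, mul_pow (r ^ _) (s ^ _) k, h1, h2, mul_assoc (_ ^ (k * _ / _))]

/-- The identity `χ(i,j) χ(j,i) = v^(a i j)`, cleared of negative exponents. -/
lemma chi_mul_chi [Fintype I] (hd : IsSymmetrizer A d) (hA : ∀ i j, i ≠ j → A i j ≤ 0)
    (hr : r ≠ 0) (hs : s ≠ 0) {i j : I} (h : i ≠ j) :
    chi A d r s i j * chi A d r s j i * chi A d r s i i ^ (1 - A i j).toNat =
      chi A d r s i i := by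
  -- Off the diagonal one of the two Euler forms is zero by definition; the symmetrizer identifies
  -- the other with `d i * A i j` in either order.
  have he : euler A d i j + euler A d j i = d i * A i j := by
    rcases lt_or_gt_of_ne h with h' | h'
    · simp [euler, h', h'.not_gt, h.symm]
    · simp [euler, h', h'.not_gt, h, hd.symm i j]
  have hN : ((1 - A i j).toNat : ℤ) = 1 - A i j := Int.toNat_of_nonneg (by linarith [hA i j h])
  have hchi : ∀ a b : ℤ, r ^ a * s ^ (-b) * (r ^ b * s ^ (-a)) = (r * s⁻¹) ^ (a + b) := by
    intro a b
    rw [mul_zpow, inv_zpow', zpow_add₀ hr, neg_add, zpow_add₀ hs]; ring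
  have hself : chi A d r s i i = (r * s⁻¹) ^ (d i : ℤ) := by
    rw [chi_self, zpow_natCast, mul_pow, inv_pow]
  have h0 : r * s⁻¹ ≠ 0 := mul_ne_zero hr (inv_ne_zero hs)
  rw [hself, chi, chi, hchi, ← zpow_natCast _ (Int.toNat _), ← zpow_mul, ← zpow_add₀ h0, hN,
    add_comm (euler A d j i), he]
  congr 1; ring

lemma chi_self_pow_ne_one [Fintype I] (hd : IsSymmetrizer A d)
    (hrs : ∀ n : ℕ, 0 < n → (r * s⁻¹) ^ n ≠ 1) (i : I) (n : ℕ) (hn : 0 < n) :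
    chi A d r s i i ^ n ≠ 1 := by
  rw [chi_self, ← inv_pow, ← mul_pow, ← pow_mul]
  exact hrs _ (Nat.mul_pos (hd.pos i) hn)

end Scalars

/-- The hypotheses on the data under which the Serre relations are compatible with the
skew derivations. -/
structure Admissible (A : Matrix I I ℤ) (d : I → ℕ) (r s : K) : Prop where
  ne_zero (i j : I) : chi A d r s i j ≠ 0
  ne_zero' (i j : I) : chi' A d r s i j ≠ 0
  pow_ne_one (i : I) (n : ℕ) : 0 < n → chi A d r s i i ^ n ≠ 1
  degree_pos (i j : I) : i ≠ j → 0 < (1 - A i j).toNat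
  mul_chi (i j : I) : i ≠ j →
    chi A d r s i j * chi A d r s j i * chi A d r s i i ^ (1 - A i j).toNat = chi A d r s i i
  isSerreCoeff (i j : I) :
    IsSerreCoeff (chi A d r s i i) (chi A d r s i j) (1 - A i j).toNat (serreCoeff A d r s i j)

lemma admissible [Fintype I] {A : Matrix I I ℤ} {d : I → ℕ} {r s : K}
    (hd : IsSymmetrizer A d) (hA : ∀ i j, i ≠ j → A i j ≤ 0)
    (hr : r ≠ 0) (hs : s ≠ 0) (hrs : ∀ n : ℕ, 0 < n → (r * s⁻¹) ^ n ≠ 1) :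
    Admissible A d r s where
  ne_zero := chi_ne_zero hr hs
  ne_zero' := chi'_ne_zero hr hs
  pow_ne_one := chi_self_pow_ne_one hd hrs
  degree_pos i j h := by have := hA i j h; omega
  mul_chi _ _ h := chi_mul_chi hd hA hr hs h
  isSerreCoeff i j := by
    rw [serreCoeff_eq]
    exact isSerreCoeff_vBinom (chi_self_pow_ne_one hd hrs i) _ _

inductive HalfRel (A : Matrix I I ℤ) (d : I → ℕ) (r s : K) :
    FreeAlgebra K I → FreeAlgebra K I → Prop where
  | serre (i j : I) (h : i ≠ j) :
      HalfRel A d r s (serrePoly A d r s i j (FreeAlgebra.ι K i) (FreeAlgebra.ι K j)) 0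

/-- The algebra presented by the Serre relations. -/
def Half (A : Matrix I I ℤ) (d : I → ℕ) (r s : K) : Type _ := RingQuot (HalfRel A d r s)

namespace Half

variable (A : Matrix I I ℤ) (d : I → ℕ) (r s : K)

instance : Ring (Half A d r s) := inferInstanceAs (Ring (RingQuot (HalfRel A d r s)))

instance : Algebra K (Half A d r s) := inferInstanceAs (Algebra K (RingQuot (HalfRel A d r s)))

/-- The projection from the free algebra. -/
def mk : FreeAlgebra K I →ₐ[K] Half A d r s := RingQuot.mkAlgHom K (HalfRel A d r s)

lemma mk_surjective : Function.Surjective (mk A d r s) := RingQuot.mkAlgHom_surjective K _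

def x (i : I) : Half A d r s := mk A d r s (FreeAlgebra.ι K i)

lemma serrePoly_x {i j : I} (h : i ≠ j) :
    serrePoly A d r s i j (x A d r s i) (x A d r s j) = 0 := by
  rw [x, x, ← map_serrePoly, ← map_zero (mk A d r s)]
  exact RingQuot.mkAlgHom_rel K (HalfRel.serre i j h)

variable {A d r s}

def lift {R : Type*} [Ring R] [Algebra K R] (g : I → R)
    (hg : ∀ i j, i ≠ j → serrePoly A d r s i j (g i) (g j) = 0) : Half A d r s →ₐ[K] R :=
  RingQuot.liftAlgHom K ⟨FreeAlgebra.lift K g, by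
    rintro _ _ ⟨i, j, h⟩
    rw [map_serrePoly, map_zero, FreeAlgebra.lift_ι_apply, FreeAlgebra.lift_ι_apply, hg i j h]⟩

@[simp] lemma lift_x {R : Type*} [Ring R] [Algebra K R] (g : I → R)
    (hg : ∀ i j, i ≠ j → serrePoly A d r s i j (g i) (g j) = 0) (i : I) :
    lift g hg (x A d r s i) = g i :=
  (RingQuot.liftAlgHom_mkAlgHom_apply K _ _ _).trans (FreeAlgebra.lift_ι_apply _ _)

lemma hom_ext {R : Type*} [Ring R] [Algebra K R] {φ ψ : Half A d r s →ₐ[K] R}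
    (h : ∀ i, φ (x A d r s i) = ψ (x A d r s i)) : φ = ψ := by
  apply RingQuot.ringQuot_ext'
  ext i
  exact h i

lemma adjoin_x : Algebra.adjoin K (Set.range (x A d r s)) = ⊤ := by
  have h := congrArg (Subalgebra.map (mk A d r s))
    (FreeAlgebra.adjoin_range_ι K I)
  rw [AlgHom.map_adjoin, ← Set.range_comp, Algebra.map_top,
    (AlgHom.range_eq_top _).2 (mk_surjective A d r s)] at h
  exact h

/-- To prove a linear property for all elements, check it is stable under left multiplication
by the generators. -/
lemma induction_left {p : Half A d r s → Prop} (one : p 1)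
    (add : ∀ y z, p y → p z → p (y + z)) (smul : ∀ (c : K) y, p y → p (c • y))
    (mul : ∀ i y, p y → p (x A d r s i * y)) (y : Half A d r s) : p y := by
  have hy : y ∈ Algebra.adjoin K (Set.range (x A d r s)) := by rw [adjoin_x]; trivial
  suffices ∀ z, p z → p (y * z) by simpa using this 1 one
  induction hy using Algebra.adjoin_induction with
  | mem _ h => obtain ⟨i, rfl⟩ := h; exact fun z => mul i z
  | algebraMap c => intro z hz; rw [← Algebra.smul_def]; exact smul c z hz
  | add a b _ _ ha hb => intro z hz; rw [add_mul]; exact add _ _ (ha z hz) (hb z hz)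
  | mul a b _ _ ha hb => intro z hz; rw [mul_assoc]; exact ha _ (hb z hz)

/-- The endomorphism `x i ↦ a i • x i`. -/
def scale (a : I → K) : Half A d r s →ₐ[K] Half A d r s :=
  lift (fun i => a i • x A d r s i) fun i j h => by
    rw [serrePoly, serreSum_smul, ← serrePoly, serrePoly_x A d r s h, smul_zero]

@[simp] lemma scale_x (a : I → K) (i : I) :
    scale a (x A d r s i) = a i • x A d r s i := lift_x _ _ _

lemma scale_scale (a b : I → K) (y : Half A d r s) :
    scale a (scale b y) = scale (a * b) y := by
  have : (scale a).comp (scale b) = scale (A := A) (d := d) (r := r) (s := s) (a * b) :=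
    hom_ext fun i => by simp [smul_smul, mul_comm]
  exact DFunLike.congr_fun this y

lemma scale_one (y : Half A d r s) : scale 1 y = y := by
  have : scale 1 = AlgHom.id K (Half A d r s) := hom_ext fun i => by simp
  exact DFunLike.congr_fun this y

/-- The homomorphism to upper triangular matrices which encodes a skew derivation. -/
def derivMatrix (H : Admissible A d r s) (k : I) :
    Half A d r s →ₐ[K] Matrix (Fin 2) (Fin 2) (Half A d r s) :=
  -- Matrix multiplication turns the corner entry into a skew derivation, so its descent to the
  -- quotient becomes the Serre relation for these matrices.
  lift (fun j => !![chi A d r s k j • x A d r s j, if k = j then 1 else 0; 0, x A d r s j])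
    fun i j h => by
      have hS := serrePoly_x A d r s h
      rw [serrePoly] at hS ⊢
      by_cases hi : k = i
      · subst hi
        rw [if_pos rfl, if_neg h]
        exact serreSum_matrix_left (H.isSerreCoeff _ _) hS
      by_cases hj : k = j
      · subst hj
        rw [if_pos rfl, if_neg hi]
        refine serreSum_matrix_right ?_ hS
        have hne : chi A d r s i i ≠ 0 := H.ne_zero i i
        -- The number required to be a root is `χ(k,i)`; by `mul_chi` it is the one belonging to the
        -- last factor.
        exact (H.isSerreCoeff i k).sum_eq_zero_of_mul_eq_pow (H.pow_ne_one i) hne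
          (H.degree_pos i k h) (H.mul_chi i k h)
      · rw [if_neg hi, if_neg hj]
        exact serreSum_matrix_diagonal hS

/-- The left skew derivation `D` with `D (x j * y) = χ(k,j) x j * D y + δ_{kj} y`. -/
def deriv (H : Admissible A d r s) (k : I) : Half A d r s →ₗ[K] Half A d r s :=
  Matrix.entryLinearMap K (Half A d r s) 0 1 ∘ₗ (derivMatrix H k).toLinearMap

lemma derivMatrix_one_one (H : Admissible A d r s) (k : I) (y : Half A d r s) :
    derivMatrix H k y 1 1 = y := by
  induction y using induction_left with
  | one => simp
  | add y z hy hz => simp [hy, hz]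
  | smul c y hy => simp [hy]
  | mul i y hy => rw [map_mul, Matrix.mul_apply, Fin.sum_univ_two, hy]; simp [derivMatrix]

lemma deriv_one (H : Admissible A d r s) (k : I) : deriv H k 1 = 0 := by
  simp [deriv]

lemma deriv_x_mul (H : Admissible A d r s) (k i : I) (y : Half A d r s) :
    deriv H k (x A d r s i * y) =
      chi A d r s k i • (x A d r s i * deriv H k y) + if k = i then y else 0 := by
  have h : ∀ y, deriv H k y = derivMatrix H k y 0 1 := fun _ => rfl
  rw [h, h, map_mul, Matrix.mul_apply, Fin.sum_univ_two, derivMatrix_one_one]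
  split_ifs with hk <;> simp [derivMatrix, hk]

lemma deriv_scale (H : Admissible A d r s) (k : I) (a : I → K) (y : Half A d r s) :
    deriv H k (scale a y) = a k • scale a (deriv H k y) := by
  induction y using induction_left with
  | one => simp [deriv_one]
  | add y z hy hz => simp [hy, hz]
  | smul c y hy => rw [map_smul, map_smul, hy, map_smul, map_smul, smul_comm]
  | mul i y hy =>
    rw [map_mul, scale_x, smul_mul_assoc, map_smul, deriv_x_mul, deriv_x_mul, hy]
    split_ifs with hk
    · subst hk
      simp only [map_add, map_smul, map_mul, scale_x, smul_add, mul_smul_comm, smul_mul_assoc,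
        smul_smul]
    · simp only [map_smul, map_mul, scale_x, mul_smul_comm, smul_mul_assoc, add_zero,
        smul_smul]
      congr 1; ring

end Half

end Halves

/-! ### The group algebra of a free abelian group. -/

section Torus

variable (K J : Type*) [Field K]

/-- Relations of the group algebra of the free abelian group on `J`; `inl j` is a generator and
`inr j` its inverse. -/
inductive TorusRel : FreeAlgebra K (J ⊕ J) → FreeAlgebra K (J ⊕ J) → Prop where
  | mul_inv (j : J) : TorusRel (FreeAlgebra.ι K (.inl j) * FreeAlgebra.ι K (.inr j)) 1
  | inv_mul (j : J) : TorusRel (FreeAlgebra.ι K (.inr j) * FreeAlgebra.ι K (.inl j)) 1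
  | comm (i j : J) : TorusRel (FreeAlgebra.ι K (.inl i) * FreeAlgebra.ι K (.inl j))
      (FreeAlgebra.ι K (.inl j) * FreeAlgebra.ι K (.inl i))

def Torus : Type _ := RingQuot (TorusRel K J)

namespace Torus

instance : Ring (Torus K J) := inferInstanceAs (Ring (RingQuot (TorusRel K J)))

instance : Algebra K (Torus K J) := inferInstanceAs (Algebra K (RingQuot (TorusRel K J)))

/-- The projection from the free algebra. -/
def mk : FreeAlgebra K (J ⊕ J) →ₐ[K] Torus K J := RingQuot.mkAlgHom K (TorusRel K J)

lemma mk_surjective : Function.Surjective (mk K J) := RingQuot.mkAlgHom_surjective K _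

variable {J}

def t (j : J ⊕ J) : Torus K J := mk K J (FreeAlgebra.ι K j)

lemma t_mul_inv (j : J) : t K (.inl j) * t K (.inr j) = 1 := by
  rw [t, t, ← map_mul, ← map_one (mk K J)]
  exact RingQuot.mkAlgHom_rel K (TorusRel.mul_inv j)

lemma t_inv_mul (j : J) : t K (.inr j) * t K (.inl j) = 1 := by
  rw [t, t, ← map_mul, ← map_one (mk K J)]
  exact RingQuot.mkAlgHom_rel K (TorusRel.inv_mul j)

lemma t_comm (i j : J) : t K (.inl i) * t K (.inl j) = t K (.inl j) * t K (.inl i) := by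
  rw [t, t, ← map_mul, ← map_mul]
  exact RingQuot.mkAlgHom_rel K (TorusRel.comm i j)

variable {K}

def lift {R : Type*} [Ring R] [Algebra K R] (g g' : J → R) (h : ∀ j, g j * g' j = 1)
    (h' : ∀ j, g' j * g j = 1) (hc : ∀ i j, g i * g j = g j * g i) : Torus K J →ₐ[K] R :=
  RingQuot.liftAlgHom K ⟨FreeAlgebra.lift K (Sum.elim g g'), by
    rintro _ _ (j | j | ⟨i, j⟩)
    · simp [h]
    · simp [h']
    · simp [hc i j]⟩

section

variable {R : Type*} [Ring R] [Algebra K R] (g g' : J → R) (h : ∀ j, g j * g' j = 1)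
    (h' : ∀ j, g' j * g j = 1) (hc : ∀ i j, g i * g j = g j * g i)

@[simp] lemma lift_inl (j : J) : lift (K := K) g g' h h' hc (t K (.inl j)) = g j :=
  (RingQuot.liftAlgHom_mkAlgHom_apply K _ _ _).trans (FreeAlgebra.lift_ι_apply _ _)

@[simp] lemma lift_inr (j : J) : lift (K := K) g g' h h' hc (t K (.inr j)) = g' j :=
  (RingQuot.liftAlgHom_mkAlgHom_apply K _ _ _).trans (FreeAlgebra.lift_ι_apply _ _)

end

lemma hom_ext {R : Type*} [Ring R] [Algebra K R] {φ ψ : Torus K J →ₐ[K] R}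
    (h : ∀ j, φ (t K j) = ψ (t K j)) : φ = ψ := by
  apply RingQuot.ringQuot_ext'
  ext i
  exact h i

lemma adjoin_t : Algebra.adjoin K (Set.range (t K (J := J))) = ⊤ := by
  have h := congrArg (Subalgebra.map (mk K J))
    (FreeAlgebra.adjoin_range_ι K (J ⊕ J))
  rw [AlgHom.map_adjoin, ← Set.range_comp, Algebra.map_top,
    (AlgHom.range_eq_top _).2 (mk_surjective K J)] at h
  exact h

lemma induction_left {p : Torus K J → Prop} (one : p 1)
    (add : ∀ y z, p y → p z → p (y + z)) (smul : ∀ (c : K) y, p y → p (c • y))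
    (mul : ∀ i y, p y → p (t K i * y)) (y : Torus K J) : p y := by
  have hy : y ∈ Algebra.adjoin K (Set.range (t K (J := J))) := by rw [adjoin_t]; trivial
  suffices ∀ z, p z → p (y * z) by simpa using this 1 one
  induction hy using Algebra.adjoin_induction with
  | mem _ h => obtain ⟨i, rfl⟩ := h; exact fun z => mul i z
  | algebraMap c => intro z hz; rw [← Algebra.smul_def]; exact smul c z hz
  | add a b _ _ ha hb => intro z hz; rw [add_mul]; exact add _ _ (ha z hz) (hb z hz)
  | mul a b _ _ ha hb => intro z hz; rw [mul_assoc]; exact ha _ (hb z hz)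

/-- The endomorphism `t j ↦ a j • t j`. -/
def scale (a : J → Kˣ) : Torus K J →ₐ[K] Torus K J :=
  lift (fun j => (a j : K) • t K (.inl j)) (fun j => (a j : K)⁻¹ • t K (.inr j))
    (fun j => by simp [smul_smul, t_mul_inv]) (fun j => by simp [smul_smul, t_inv_mul])
    (fun i j => by simp only [smul_mul_smul_comm, t_comm K i j, mul_comm])

@[simp] lemma scale_inl (a : J → Kˣ) (j : J) :
    scale a (t K (.inl j)) = (a j : K) • t K (.inl j) := by simp [scale]

@[simp] lemma scale_inr (a : J → Kˣ) (j : J) :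
    scale a (t K (.inr j)) = (a j : K)⁻¹ • t K (.inr j) := by simp [scale]

lemma scale_comm (a b : J → Kˣ) (y : Torus K J) : scale a (scale b y) = scale b (scale a y) := by
  have : (scale a).comp (scale b) = (scale b).comp (scale (K := K) a) :=
    hom_ext fun i => by rcases i with i | i <;> simp [smul_smul, mul_comm]
  exact DFunLike.congr_fun this y

end Torus

end Torus

/-! ### Serre polynomials of operators on tensor products. -/

section SerreOperators

variable {K : Type*} [Field K]

lemma serreSum_intertwine {M N : Type*} [AddCommGroup M] [Module K M] [AddCommGroup N]
    [Module K N] (ι : M →ₗ[K] N) {X Y : Module.End K N} {X' Y' : Module.End K M}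
    (hX : ∀ m, X (ι m) = ι (X' m)) (hY : ∀ m, Y (ι m) = ι (Y' m)) (q : ℕ → K) (n : ℕ) (m : M) :
    serreSum q n X Y (ι m) = ι (serreSum q n X' Y' m) := by
  have hpow : ∀ k m, (X ^ k) (ι m) = ι ((X' ^ k) m) := by
    intro k
    induction k with
    | zero => simp
    | succ k ih => intro m; rw [pow_succ, pow_succ, Module.End.mul_apply, hX, ih]; rfl
  simp [serreSum, LinearMap.sum_apply, hpow, hY]

/-- Since `P` and `Q` commute, every monomial has the same first factor `P^n Q`, which comes out of
the sum. -/
lemma serreSum_map {M N : Type*} [AddCommGroup M] [Module K M] [AddCommGroup N]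
    [Module K N] {P Q : Module.End K M} (h : Commute P Q) (X Y : Module.End K N) (q : ℕ → K)
    (n : ℕ) : serreSum q n (TensorProduct.map P X : Module.End K (M ⊗[K] N))
      (TensorProduct.map Q Y) = TensorProduct.map (P ^ n * Q) (serreSum q n X Y) := by
  have hsum : (TensorProduct.map (P ^ n * Q) (serreSum q n X Y) : Module.End K (M ⊗[K] N)) =
      TensorProduct.mapBilinear (RingHom.id K) M N M N (P ^ n * Q) (serreSum q n X Y) := rfl
  rw [hsum, serreSum, serreSum, map_sum]
  refine Finset.sum_congr rfl fun k hk => ?_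
  have hk' : P ^ n = P ^ k * P ^ (n - k) := by
    rw [← pow_add]; congr 1; have := Finset.mem_range.1 hk; omega
  rw [map_smul, TensorProduct.mapBilinear_apply, hk', mul_assoc (P ^ k), (h.pow_left (n - k)).eq,
    ← mul_assoc (P ^ k), TensorProduct.map_mul, TensorProduct.map_mul, TensorProduct.map_pow,
    TensorProduct.map_pow]

end SerreOperators

/-! ### The representation on `Half ⊗ Torus ⊗ Half`. -/

section Action

variable {K I : Type*} [Field K] [LinearOrder I]

/-- The weight by which the torus generator `j` conjugates `e i`. -/
def wt (A : Matrix I I ℤ) (d : I → ℕ) (r s : K) : I ⊕ I → I → K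
  | .inl j => chi A d r s j
  | .inr j => chi' A d r s j

/-- The underlying space of the induced module. -/
abbrev Verma (A : Matrix I I ℤ) (d : I → ℕ) (r s : K) : Type _ :=
  Half A d r s ⊗[K] (Torus K (I ⊕ I) ⊗[K] Half A d r s)

variable {A : Matrix I I ℤ} {d : I → ℕ} {r s : K}

lemma Admissible.wt_ne_zero (H : Admissible A d r s) (j : I ⊕ I) (i : I) :
    wt A d r s j i ≠ 0 := by
  rcases j with j | j
  exacts [H.ne_zero j i, H.ne_zero' j i]

/-- Conjugation by `e i` on the torus. -/
def Admissible.torusTwist (H : Admissible A d r s) (i : I) :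
    Torus K (I ⊕ I) →ₐ[K] Torus K (I ⊕ I) :=
  Torus.scale fun j => (Units.mk0 (wt A d r s j i) (H.wt_ne_zero j i))⁻¹

namespace Verma

open TensorProduct

lemma end_ext {φ ψ : Module.End K (Verma A d r s)}
    (h : ∀ x t y, φ (x ⊗ₜ (t ⊗ₜ y)) = ψ (x ⊗ₜ (t ⊗ₜ y))) : φ = ψ :=
  TensorProduct.ext (LinearMap.ext fun x => TensorProduct.ext' fun t y => h x t y)

variable (A d r s) in
def opF (i : I) : Module.End K (Verma A d r s) :=
  TensorProduct.map (LinearMap.mulLeft K (Half.x A d r s i)) LinearMap.id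

/-- The operator of `e i` on `T ⊗ B⁺`. -/
def borelE (H : Admissible A d r s) (i : I) :
    Module.End K (Torus K (I ⊕ I) ⊗[K] Half A d r s) :=
  TensorProduct.map (H.torusTwist i).toLinearMap (Algebra.lmul K _ (Half.x A d r s i))

/-- Normal ordering of `e i` against an element of the left factor: the derivation collects the
terms where `e i` is absorbed by some `f i`, and the second summand is the term where it passes
through. -/
def opE (H : Admissible A d r s) (i : I) : Module.End K (Verma A d r s) :=
  TensorProduct.map (Half.deriv H i) LinearMap.id +
    TensorProduct.map (Half.scale (chi A d r s i)).toLinearMap (borelE H i)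

variable (A d r s) in
def opT : (I ⊕ I) ⊕ (I ⊕ I) → Module.End K (Verma A d r s)
  | .inl j => TensorProduct.map (Half.scale (wt A d r s j)⁻¹).toLinearMap
      (TensorProduct.map (LinearMap.mulLeft K (Torus.t K (.inl j))) LinearMap.id)
  | .inr j => TensorProduct.map (Half.scale (wt A d r s j)).toLinearMap
      (TensorProduct.map (LinearMap.mulLeft K (Torus.t K (.inr j))) LinearMap.id)

@[simp] lemma opF_tmul (i : I) (x : Half A d r s) (m : Torus K (I ⊕ I) ⊗[K] Half A d r s) :
    opF A d r s i (x ⊗ₜ m) = (Half.x A d r s i * x) ⊗ₜ m := rfl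

@[simp] lemma borelE_tmul (H : Admissible A d r s) (i : I) (t : Torus K (I ⊕ I))
    (y : Half A d r s) :
    borelE H i (t ⊗ₜ y) = H.torusTwist i t ⊗ₜ (Half.x A d r s i * y) := rfl

@[simp] lemma opE_tmul (H : Admissible A d r s) (i : I) (x : Half A d r s)
    (m : Torus K (I ⊕ I) ⊗[K] Half A d r s) :
    opE H i (x ⊗ₜ m) = Half.deriv H i x ⊗ₜ m + Half.scale (chi A d r s i) x ⊗ₜ borelE H i m := rfl

@[simp] lemma opT_inl_tmul (j : I ⊕ I) (x : Half A d r s) (t : Torus K (I ⊕ I))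
    (y : Half A d r s) : opT A d r s (.inl j) (x ⊗ₜ (t ⊗ₜ y)) =
      Half.scale (wt A d r s j)⁻¹ x ⊗ₜ ((Torus.t K (.inl j) * t) ⊗ₜ y) := rfl

@[simp] lemma opT_inr_tmul (j : I ⊕ I) (x : Half A d r s) (t : Torus K (I ⊕ I))
    (y : Half A d r s) : opT A d r s (.inr j) (x ⊗ₜ (t ⊗ₜ y)) =
      Half.scale (wt A d r s j) x ⊗ₜ ((Torus.t K (.inr j) * t) ⊗ₜ y) := rfl

lemma opT_mul_inv (H : Admissible A d r s) (j : I ⊕ I) :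
    opT A d r s (.inl j) * opT A d r s (.inr j) = 1 := by
  refine end_ext fun x t y => ?_
  have h : (wt A d r s j)⁻¹ * wt A d r s j = 1 :=
    funext fun i => inv_mul_cancel₀ (H.wt_ne_zero j i)
  simp [Half.scale_scale, h, Half.scale_one, ← mul_assoc, Torus.t_mul_inv]

lemma opT_inv_mul (H : Admissible A d r s) (j : I ⊕ I) :
    opT A d r s (.inr j) * opT A d r s (.inl j) = 1 := by
  refine end_ext fun x t y => ?_
  have h : wt A d r s j * (wt A d r s j)⁻¹ = 1 :=
    funext fun i => mul_inv_cancel₀ (H.wt_ne_zero j i)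
  simp [Half.scale_scale, h, Half.scale_one, ← mul_assoc, Torus.t_inv_mul]

lemma opT_comm (i j : I ⊕ I) :
    opT A d r s (.inl i) * opT A d r s (.inl j) = opT A d r s (.inl j) * opT A d r s (.inl i) := by
  refine end_ext fun x t y => ?_
  simp [Half.scale_scale, ← mul_assoc, Torus.t_comm K i j, mul_comm]

lemma opT_mul_opF (j : I ⊕ I) (i : I) :
    opT A d r s (.inl j) * opF A d r s i =
      (wt A d r s j i)⁻¹ • (opF A d r s i * opT A d r s (.inl j)) := by
  refine end_ext fun x t y => ?_
  simp [smul_tmul']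

lemma opT_mul_opE (H : Admissible A d r s) (j : I ⊕ I) (i : I) :
    opT A d r s (.inl j) * opE H i = wt A d r s j i • (opE H i * opT A d r s (.inl j)) := by
  refine end_ext fun x t y => ?_
  have h0 := H.wt_ne_zero j i
  simp only [Module.End.mul_apply, opE_tmul, borelE_tmul, map_add, opT_inl_tmul,
    LinearMap.smul_apply, smul_add, Half.deriv_scale, Half.scale_scale]
  congr 1
  · rw [smul_tmul', smul_smul, Pi.inv_apply, mul_inv_cancel₀ h0, one_smul]
  · rw [map_mul, Admissible.torusTwist, Torus.scale_inl, smul_mul_assoc, ← smul_tmul',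
      tmul_smul, smul_smul, Units.val_inv_eq_inv_val, Units.val_mk0, mul_inv_cancel₀ h0, one_smul,
      mul_comm]

lemma opE_mul_opF (H : Admissible A d r s) (i j : I) :
    opE H i * opF A d r s j =
      chi A d r s i j • (opF A d r s j * opE H i) + if i = j then 1 else 0 := by
  refine end_ext fun x t y => ?_
  simp only [Module.End.mul_apply, opF_tmul, opE_tmul, Half.deriv_x_mul, LinearMap.add_apply,
    LinearMap.smul_apply, map_add, smul_add, add_tmul, smul_tmul', map_mul, Half.scale_x,
    smul_mul_assoc]
  split_ifs
  · simp only [Module.End.one_apply]; abel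
  · simp

/-- The operators `opF` come from the left regular representation of `Half`, where the relation
holds by construction. -/
lemma serrePoly_opF {i j : I} (h : i ≠ j) :
    serrePoly A d r s i j (opF A d r s i) (opF A d r s j) = 0 := by
  let φ : Half A d r s →ₐ[K] Module.End K (Verma A d r s) :=
    (Module.End.rTensorAlgHom K (Half A d r s) (Torus K (I ⊕ I) ⊗[K] Half A d r s)).comp
      (Algebra.lmul K (Half A d r s))
  have hφ : ∀ i, opF A d r s i = φ (Half.x A d r s i) := fun _ => rfl
  rw [hφ, hφ, ← map_serrePoly, Half.serrePoly_x A d r s h, map_zero]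

lemma serrePoly_borelE (H : Admissible A d r s) {i j : I} (h : i ≠ j) :
    serrePoly A d r s i j (borelE H i) (borelE H j) = 0 := by
  have hc : Commute (H.torusTwist i).toLinearMap (H.torusTwist j).toLinearMap :=
    LinearMap.ext fun y => Torus.scale_comm _ _ _
  rw [serrePoly, borelE, borelE, serreSum_map hc, ← map_serreSum, ← serrePoly,
    Half.serrePoly_x A d r s h, map_zero, TensorProduct.map_zero_right]

/-- The Serre operator `S` commutes with each `opF k` up to a scalar, so it is enough that `S` kills
`1 ⊗ m`, as such vectors generate the module under the `opF k`. On them the derivations vanish and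
`opE` acts as `borelE`, for which the relation is inherited from `Half`. -/
lemma serrePoly_opE (H : Admissible A d r s) {i j : I} (h : i ≠ j) :
    serrePoly A d r s i j (opE H i) (opE H j) = 0 := by
  set S := serrePoly A d r s i j (opE H i) (opE H j) with hS
  have hcomm : ∀ k, ∃ c : K, S * opF A d r s k = c • (opF A d r s k * S) := by
    intro k
    have hx := opE_mul_opF H i k
    have hy := opE_mul_opF H j k
    by_cases hi : i = k
    · subst hi
      rw [if_pos rfl] at hx
      rw [if_neg h.symm, add_zero] at hy
      exact ⟨_, serreSum_mul_of_skew_comm_left (H.isSerreCoeff i j) (H.mul_chi i j h)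
        (H.ne_zero i i) hx hy⟩
    rw [if_neg hi, add_zero] at hx
    by_cases hj : j = k
    · subst hj
      rw [if_pos rfl] at hy
      exact ⟨_, serreSum_mul_of_skew_comm_right (H.pow_ne_one i) (H.degree_pos i j h)
        (H.isSerreCoeff i j) (H.ne_zero i j) hx hy⟩
    · rw [if_neg hj, add_zero] at hy
      exact ⟨_, serreSum_mul_of_q_comm hx hy⟩
  have hone : ∀ m, S ((1 : Half A d r s) ⊗ₜ m) = 0 := by
    intro m
    have key := serreSum_intertwine (TensorProduct.mk K (Half A d r s) _ 1)
      (X := opE H i) (Y := opE H j) (X' := borelE H i) (Y' := borelE H j)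
      (fun m => by simp [Half.deriv_one]) (fun m => by simp [Half.deriv_one])
      (serreCoeff A d r s i j) (1 - A i j).toNat m
    rw [← serrePoly, ← serrePoly, serrePoly_borelE H h] at key
    simpa using key
  refine end_ext fun x t y => ?_
  rw [LinearMap.zero_apply]
  generalize t ⊗ₜ[K] y = m
  induction x using Half.induction_left with
  | one => exact hone m
  | add y z hy hz => rw [add_tmul, map_add, hy, hz, add_zero]
  | smul c y hy => rw [← smul_tmul', map_smul, hy, smul_zero]
  | mul k y hy =>
    obtain ⟨c, hc⟩ := hcomm k
    rw [← opF_tmul, ← Module.End.mul_apply, hc, LinearMap.smul_apply, Module.End.mul_apply, hy,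
      map_zero, smul_zero]

/-- The operators of the generators. -/
def genOp (H : Admissible A d r s) : Gen I → Module.End K (Verma A d r s)
  | .e i => opE H i
  | .f i => opF A d r s i
  | .w i => opT A d r s (.inl (.inl i))
  | .wInv i => opT A d r s (.inr (.inl i))
  | .w' i => opT A d r s (.inl (.inr i))
  | .w'Inv i => opT A d r s (.inr (.inr i))

lemma opT_conj_opE (H : Admissible A d r s) (j : I ⊕ I) (i : I) :
    opT A d r s (.inl j) * opE H i * opT A d r s (.inr j) = wt A d r s j i • opE H i := by
  rw [opT_mul_opE, smul_mul_assoc, mul_assoc, opT_mul_inv H, mul_one]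

lemma opT_conj_opF (H : Admissible A d r s) (j : I ⊕ I) (i : I) :
    opT A d r s (.inl j) * opF A d r s i * opT A d r s (.inr j) =
      (wt A d r s j i)⁻¹ • opF A d r s i := by
  rw [opT_mul_opF, smul_mul_assoc, mul_assoc, opT_mul_inv H, mul_one]

/-- The representation of the Kashiwara algebra. -/
def rep (H : Admissible A d r s) : Kashiwara A d r s →ₐ[K] Module.End K (Verma A d r s) :=
  RingQuot.liftAlgHom K ⟨FreeAlgebra.lift K (genOp H), by
    intro x y hxy
    induction hxy with
    | w_mul_inv i => simpa [genOp] using opT_mul_inv H _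
    | inv_mul_w i => simpa [genOp] using opT_inv_mul H _
    | w'_mul_inv i => simpa [genOp] using opT_mul_inv H _
    | inv_mul_w' i => simpa [genOp] using opT_inv_mul H _
    | w_comm i j => simpa [genOp] using opT_comm _ _
    | w'_comm i j => simpa [genOp] using opT_comm _ _
    | w_w'_comm i j => simpa [genOp] using opT_comm _ _
    | w_e i j => simpa [genOp, wt] using opT_conj_opE H (.inl i) j
    | w'_e i j => simpa [genOp, wt] using opT_conj_opE H (.inr i) j
    | w_f i j => simpa [genOp, wt, chi, zpow_neg, mul_comm] using opT_conj_opF H (.inl i) j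
    | w'_f i j => simpa [genOp, wt, chi', zpow_neg, mul_comm] using opT_conj_opF H (.inr i) j
    | e_f i j =>
      have := opE_mul_opF H i j
      split_ifs at this ⊢ <;> simpa [genOp] using this
    | serre_e i j h =>
      refine (map_serrePoly A d r s i j (FreeAlgebra.lift K (genOp H)) _ _).trans ?_
      simpa [genOp] using serrePoly_opE H h
    | serre_f i j h =>
      refine (map_serrePoly A d r s i j (FreeAlgebra.lift K (genOp H)) _ _).trans ?_
      simpa [genOp] using serrePoly_opF h⟩

@[simp] lemma rep_mkGen (H : Admissible A d r s) (g : Gen I) :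
    rep H (mkGen A d r s g) = genOp H g := by
  simp [rep, mkGen]

end Verma

end Action

/-! ### Normal ordering in the Kashiwara algebra and bijectivity of multiplication. -/

section Triangular

variable {K I : Type*} [Field K] [LinearOrder I] (A : Matrix I I ℤ) (d : I → ℕ) (r s : K)

lemma mkGen_serre_e {i j : I} (h : i ≠ j) :
    serrePoly A d r s i j (mkGen A d r s (.e i)) (mkGen A d r s (.e j)) = 0 :=
  (map_serrePoly A d r s i j (RingQuot.mkAlgHom K (Rel A d r s)) _ _).symm.trans
    ((RingQuot.mkAlgHom_rel K (Rel.serre_e i j h)).trans (map_zero _))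

lemma mkGen_serre_f {i j : I} (h : i ≠ j) :
    serrePoly A d r s i j (mkGen A d r s (.f i)) (mkGen A d r s (.f j)) = 0 :=
  (map_serrePoly A d r s i j (RingQuot.mkAlgHom K (Rel A d r s)) _ _).symm.trans
    ((RingQuot.mkAlgHom_rel K (Rel.serre_f i j h)).trans (map_zero _))

/-- The torus generators in the Kashiwara algebra. -/
def torusGen : I ⊕ I → Kashiwara A d r s
  | .inl i => mkGen A d r s (.w i)
  | .inr i => mkGen A d r s (.w' i)

/-- The inverses of the torus generators in the Kashiwara algebra. -/
def torusGenInv : I ⊕ I → Kashiwara A d r s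
  | .inl i => mkGen A d r s (.wInv i)
  | .inr i => mkGen A d r s (.w'Inv i)

variable {A d r s} in
lemma rel_eq {x y : FreeAlgebra K (Gen I)} (h : Rel A d r s x y) :
    RingQuot.mkAlgHom K (Rel A d r s) x = RingQuot.mkAlgHom K (Rel A d r s) y :=
  RingQuot.mkAlgHom_rel K h

lemma torusGen_mul_inv (j : I ⊕ I) : torusGen A d r s j * torusGenInv A d r s j = 1 := by
  rcases j with i | i
  · simpa [mkGen, torusGen, torusGenInv] using
      rel_eq (Rel.w_mul_inv (A := A) (d := d) (r := r) (s := s) i)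
  · simpa [mkGen, torusGen, torusGenInv] using
      rel_eq (Rel.w'_mul_inv (A := A) (d := d) (r := r) (s := s) i)

lemma torusGen_inv_mul (j : I ⊕ I) : torusGenInv A d r s j * torusGen A d r s j = 1 := by
  rcases j with i | i
  · simpa [mkGen, torusGen, torusGenInv] using
      rel_eq (Rel.inv_mul_w (A := A) (d := d) (r := r) (s := s) i)
  · simpa [mkGen, torusGen, torusGenInv] using
      rel_eq (Rel.inv_mul_w' (A := A) (d := d) (r := r) (s := s) i)

lemma torusGen_comm (i j : I ⊕ I) :
    torusGen A d r s i * torusGen A d r s j = torusGen A d r s j * torusGen A d r s i := by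
  rcases i with i | i <;> rcases j with j | j
  · simpa [mkGen, torusGen] using
      rel_eq (Rel.w_comm (A := A) (d := d) (r := r) (s := s) i j)
  · simpa [mkGen, torusGen] using
      rel_eq (Rel.w_w'_comm (A := A) (d := d) (r := r) (s := s) i j)
  · simpa [mkGen, torusGen] using
      (rel_eq (Rel.w_w'_comm (A := A) (d := d) (r := r) (s := s) j i)).symm
  · simpa [mkGen, torusGen] using
      rel_eq (Rel.w'_comm (A := A) (d := d) (r := r) (s := s) i j)

lemma torusGen_conj_e (j : I ⊕ I) (i : I) :
    torusGen A d r s j * mkGen A d r s (.e i) * torusGenInv A d r s j =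
      wt A d r s j i • mkGen A d r s (.e i) := by
  rcases j with j | j
  · simpa [mkGen, torusGen, torusGenInv, wt] using
      rel_eq (Rel.w_e (A := A) (d := d) (r := r) (s := s) j i)
  · simpa [mkGen, torusGen, torusGenInv, wt] using
      rel_eq (Rel.w'_e (A := A) (d := d) (r := r) (s := s) j i)

lemma torusGen_conj_f (j : I ⊕ I) (i : I) :
    torusGen A d r s j * mkGen A d r s (.f i) * torusGenInv A d r s j =
      (wt A d r s j i)⁻¹ • mkGen A d r s (.f i) := by
  rcases j with j | j
  · simpa [mkGen, torusGen, torusGenInv, wt, chi, zpow_neg, mul_comm] using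
      rel_eq (Rel.w_f (A := A) (d := d) (r := r) (s := s) j i)
  · simpa [mkGen, torusGen, torusGenInv, wt, chi', zpow_neg, mul_comm] using
      rel_eq (Rel.w'_f (A := A) (d := d) (r := r) (s := s) j i)

lemma mkGen_e_mul_f (i j : I) :
    mkGen A d r s (.e i) * mkGen A d r s (.f j) =
      chi A d r s i j • (mkGen A d r s (.f j) * mkGen A d r s (.e i)) +
        if i = j then 1 else 0 := by
  have := rel_eq (Rel.e_f (A := A) (d := d) (r := r) (s := s) i j)
  split_ifs at this ⊢ <;> simpa [mkGen] using this

def ofHalfF : Half A d r s →ₐ[K] Kashiwara A d r s :=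
  Half.lift (fun i => mkGen A d r s (.f i)) fun _ _ h => mkGen_serre_f A d r s h

def ofHalfE : Half A d r s →ₐ[K] Kashiwara A d r s :=
  Half.lift (fun i => mkGen A d r s (.e i)) fun _ _ h => mkGen_serre_e A d r s h

def ofTorus : Torus K (I ⊕ I) →ₐ[K] Kashiwara A d r s :=
  Torus.lift (torusGen A d r s) (torusGenInv A d r s) (torusGen_mul_inv A d r s)
    (torusGen_inv_mul A d r s) (torusGen_comm A d r s)

lemma range_ofHalfF : (ofHalfF A d r s).range = Bminus A d r s := by
  rw [← Algebra.map_top, ← Half.adjoin_x, AlgHom.map_adjoin, ← Set.range_comp, Bminus]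
  congr 1
  ext y
  simp [ofHalfF, eq_comm]

lemma range_ofHalfE : (ofHalfE A d r s).range = Bplus A d r s := by
  rw [← Algebra.map_top, ← Half.adjoin_x, AlgHom.map_adjoin, ← Set.range_comp, Bplus]
  congr 1
  ext y
  simp [ofHalfE, eq_comm]

lemma range_ofTorus : (ofTorus A d r s).range = T A d r s := by
  rw [← Algebra.map_top, ← Torus.adjoin_t, AlgHom.map_adjoin, ← Set.range_comp, T]
  congr 1
  ext y
  simp only [Set.mem_range, Function.comp_apply, Sum.exists, Set.mem_ofPred_eq, ofTorus,
    Torus.lift_inl, Torus.lift_inr, torusGen, torusGenInv]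
  constructor
  · rintro ((⟨i, h⟩ | ⟨i, h⟩) | (⟨i, h⟩ | ⟨i, h⟩)) <;> exact ⟨i, by simp [h]⟩
  · rintro ⟨i, h | h | h | h⟩ <;> simp [h]

/-- The multiplication map from the presented triangular parts. -/
def triMul : Verma A d r s →ₗ[K] Kashiwara A d r s :=
  LinearMap.mul' K _ ∘ₗ TensorProduct.map (ofHalfF A d r s).toLinearMap
    (LinearMap.mul' K _ ∘ₗ
      TensorProduct.map (ofTorus A d r s).toLinearMap (ofHalfE A d r s).toLinearMap)

lemma triMul_tmul (x : Half A d r s) (t : Torus K (I ⊕ I)) (y : Half A d r s) :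
    triMul A d r s (x ⊗ₜ (t ⊗ₜ y)) = ofHalfF A d r s x * (ofTorus A d r s t * ofHalfE A d r s y) :=
  rfl

variable {A d r s}

open TensorProduct Verma

lemma rep_ofHalfF (H : Admissible A d r s) (x z : Half A d r s)
    (m : Torus K (I ⊕ I) ⊗[K] Half A d r s) :
    rep H (ofHalfF A d r s x) (z ⊗ₜ m) = (x * z) ⊗ₜ m := by
  induction x using Half.induction_left with
  | one => simp
  | add a b ha hb => simp [add_mul, add_tmul, ha, hb]
  | smul c a ha => simp [ha, smul_tmul']
  | mul i a ha =>
    rw [map_mul, map_mul, Module.End.mul_apply, ha]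
    simp [ofHalfF, genOp, mul_assoc]

/-- The left factor must be `1`, which the rescalings fix; in general it would be rescaled. -/
lemma rep_ofTorus (H : Admissible A d r s) (t u : Torus K (I ⊕ I)) (y : Half A d r s) :
    rep H (ofTorus A d r s t) (1 ⊗ₜ (u ⊗ₜ y)) = 1 ⊗ₜ ((t * u) ⊗ₜ y) := by
  induction t using Torus.induction_left with
  | one => simp
  | add a b ha hb => simp [add_mul, add_tmul, tmul_add, ha, hb]
  | smul c a ha => simp [ha, ← smul_tmul']
  | mul i a ha =>
    rw [map_mul, map_mul, Module.End.mul_apply, ha]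
    rcases i with (i | i) | (i | i) <;>
      simp [ofTorus, torusGen, torusGenInv, genOp, mul_assoc]

/-- With `1` in the first two factors, the derivation term vanishes and the torus twist acts
trivially. -/
lemma rep_ofHalfE (H : Admissible A d r s) (y z : Half A d r s) :
    rep H (ofHalfE A d r s y) (1 ⊗ₜ (1 ⊗ₜ z)) = 1 ⊗ₜ (1 ⊗ₜ (y * z)) := by
  induction y using Half.induction_left with
  | one => simp
  | add a b ha hb => simp [add_mul, tmul_add, ha, hb]
  | smul c a ha => simp [ha]
  | mul i a ha =>
    rw [map_mul, map_mul, Module.End.mul_apply, ha]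
    simp [ofHalfE, genOp, mul_assoc, Half.deriv_one]

/-- This left inverse yields injectivity. The three parts act on the cyclic vector from right to
left, each meeting `1` in its own factor and in those not yet filled. -/
lemma rep_triMul (H : Admissible A d r s) (v : Verma A d r s) :
    rep H (triMul A d r s v) (1 ⊗ₜ (1 ⊗ₜ 1)) = v := by
  let φ : Module.End K (Verma A d r s) :=
    LinearMap.applyₗ (1 ⊗ₜ (1 ⊗ₜ 1)) ∘ₗ (rep H).toLinearMap ∘ₗ triMul A d r s
  have : φ = LinearMap.id := end_ext fun x t y => by
    change rep H (triMul A d r s (x ⊗ₜ (t ⊗ₜ y))) (1 ⊗ₜ (1 ⊗ₜ 1)) = x ⊗ₜ (t ⊗ₜ y)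
    rw [triMul_tmul, map_mul, map_mul, Module.End.mul_apply, Module.End.mul_apply, rep_ofHalfE,
      rep_ofTorus, rep_ofHalfF, mul_one, mul_one, mul_one]
  exact DFunLike.congr_fun this v

/-- The counterpart inside the Kashiwara algebra of the formula defining `opE`. -/
lemma e_mul_ofHalfF (H : Admissible A d r s) (i : I) (x : Half A d r s) :
    mkGen A d r s (.e i) * ofHalfF A d r s x =
      ofHalfF A d r s (Half.scale (chi A d r s i) x) * mkGen A d r s (.e i) +
        ofHalfF A d r s (Half.deriv H i x) := by
  induction x using Half.induction_left with
  | one => simp [Half.deriv_one]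
  | add a b ha hb => simp only [map_add, mul_add, ha, hb, add_mul]; abel
  | smul c a ha => simp [ha]
  | mul j a ha =>
    have hf : ofHalfF A d r s (Half.x A d r s j) = mkGen A d r s (.f j) := Half.lift_x _ _ _
    rw [map_mul, hf, ← mul_assoc, mkGen_e_mul_f, add_mul, smul_mul_assoc, mul_assoc, ha,
      Half.deriv_x_mul]
    split_ifs <;> simp [hf, mul_add, mul_assoc, add_assoc]

lemma e_mul_torusGen (H : Admissible A d r s) (i : I) (j : I ⊕ I) :
    mkGen A d r s (.e i) * torusGen A d r s j =
      (wt A d r s j i)⁻¹ • (torusGen A d r s j * mkGen A d r s (.e i)) := by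
  have h := congrArg (· * torusGen A d r s j) (torusGen_conj_e A d r s j i)
  simp only [mul_assoc, torusGen_inv_mul, mul_one, smul_mul_assoc] at h
  rw [h, smul_smul, inv_mul_cancel₀ (H.wt_ne_zero j i), one_smul]

lemma e_mul_torusGenInv (i : I) (j : I ⊕ I) :
    mkGen A d r s (.e i) * torusGenInv A d r s j =
      wt A d r s j i • (torusGenInv A d r s j * mkGen A d r s (.e i)) := by
  have h := congrArg (torusGenInv A d r s j * ·) (torusGen_conj_e A d r s j i)
  simpa only [← mul_assoc, torusGen_inv_mul, one_mul, mul_smul_comm] using h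

lemma e_mul_ofTorus (H : Admissible A d r s) (i : I) (t : Torus K (I ⊕ I)) :
    mkGen A d r s (.e i) * ofTorus A d r s t =
      ofTorus A d r s (H.torusTwist i t) * mkGen A d r s (.e i) := by
  induction t using Torus.induction_left with
  | one => simp
  | add a b ha hb => simp only [map_add, mul_add, ha, hb, add_mul]
  | smul c a ha => simp [ha]
  | mul j a ha =>
    rw [map_mul, ← mul_assoc]
    rcases j with j | j
    · have ht : ofTorus A d r s (Torus.t K (.inl j)) = torusGen A d r s j :=
        Torus.lift_inl _ _ _ _ _ _
      rw [ht, e_mul_torusGen H, smul_mul_assoc, mul_assoc, ha]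
      simp [Admissible.torusTwist, ht, mul_assoc]
    · have ht : ofTorus A d r s (Torus.t K (.inr j)) = torusGenInv A d r s j :=
        Torus.lift_inr _ _ _ _ _ _
      rw [ht, e_mul_torusGenInv, smul_mul_assoc, mul_assoc, ha]
      simp [Admissible.torusTwist, ht, mul_assoc]

lemma torusGen_mul_ofHalfF (j : I ⊕ I) (x : Half A d r s) :
    torusGen A d r s j * ofHalfF A d r s x =
      ofHalfF A d r s (Half.scale (wt A d r s j)⁻¹ x) * torusGen A d r s j := by
  induction x using Half.induction_left with
  | one => simp
  | add a b ha hb => simp only [map_add, mul_add, ha, hb, add_mul]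
  | smul c a ha => simp [ha]
  | mul i a ha =>
    have hf : ofHalfF A d r s (Half.x A d r s i) = mkGen A d r s (.f i) := Half.lift_x _ _ _
    have h := congrArg (· * torusGen A d r s j) (torusGen_conj_f A d r s j i)
    simp only [mul_assoc, torusGen_inv_mul, mul_one, smul_mul_assoc] at h
    rw [map_mul, hf, ← mul_assoc, h, smul_mul_assoc, mul_assoc, ha]
    simp [hf, mul_assoc]

lemma torusGenInv_mul_ofHalfF (H : Admissible A d r s) (j : I ⊕ I) (x : Half A d r s) :
    torusGenInv A d r s j * ofHalfF A d r s x =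
      ofHalfF A d r s (Half.scale (wt A d r s j) x) * torusGenInv A d r s j := by
  have hw : (wt A d r s j)⁻¹ * wt A d r s j = 1 :=
    funext fun i => inv_mul_cancel₀ (H.wt_ne_zero j i)
  -- Rescaling `x` beforehand cancels the inverse weight; multiplying by the inverse generator on
  -- both sides then gives the claim.
  have h := torusGen_mul_ofHalfF j (Half.scale (wt A d r s j) x)
  rw [Half.scale_scale, hw, Half.scale_one] at h
  have h' := congrArg (fun z => torusGenInv A d r s j * z * torusGenInv A d r s j) h
  simp only [← mul_assoc, torusGen_inv_mul, one_mul] at h'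
  rw [h', mul_assoc, mul_assoc, torusGen_mul_inv, mul_one]

/-- The preimages on pure tensors are the values of the operators `genOp`: `triMul` intertwines left
multiplication with the action. -/
lemma mkGen_mul_mem_range_triMul (H : Admissible A d r s) (g : Gen I) (v : Verma A d r s) :
    mkGen A d r s g * triMul A d r s v ∈ LinearMap.range (triMul A d r s) := by
  have hT : ∀ (j : I ⊕ I) x t y, torusGen A d r s j * triMul A d r s (x ⊗ₜ (t ⊗ₜ y)) ∈
      LinearMap.range (triMul A d r s) := fun j x t y =>
    ⟨Half.scale (wt A d r s j)⁻¹ x ⊗ₜ ((Torus.t K (.inl j) * t) ⊗ₜ y), by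
      have ht : ofTorus A d r s (Torus.t K (.inl j)) = torusGen A d r s j :=
        Torus.lift_inl _ _ _ _ _ _
      rw [triMul_tmul, triMul_tmul, ← mul_assoc (torusGen A d r s j), torusGen_mul_ofHalfF,
        map_mul, ht]
      simp only [mul_assoc]⟩
  have hT' : ∀ (j : I ⊕ I) x t y, torusGenInv A d r s j * triMul A d r s (x ⊗ₜ (t ⊗ₜ y)) ∈
      LinearMap.range (triMul A d r s) := fun j x t y =>
    ⟨Half.scale (wt A d r s j) x ⊗ₜ ((Torus.t K (.inr j) * t) ⊗ₜ y), by
      have ht : ofTorus A d r s (Torus.t K (.inr j)) = torusGenInv A d r s j :=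
        Torus.lift_inr _ _ _ _ _ _
      rw [triMul_tmul, triMul_tmul, ← mul_assoc (torusGenInv A d r s j),
        torusGenInv_mul_ofHalfF H, map_mul, ht]
      simp only [mul_assoc]⟩
  have hF : ∀ i x t y, mkGen A d r s (.f i) * triMul A d r s (x ⊗ₜ (t ⊗ₜ y)) ∈
      LinearMap.range (triMul A d r s) := fun i x t y =>
    ⟨(Half.x A d r s i * x) ⊗ₜ (t ⊗ₜ y), by
      have hf : ofHalfF A d r s (Half.x A d r s i) = mkGen A d r s (.f i) := Half.lift_x _ _ _
      rw [triMul_tmul, triMul_tmul, map_mul, hf, mul_assoc]⟩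
  have hE : ∀ i x t y, mkGen A d r s (.e i) * triMul A d r s (x ⊗ₜ (t ⊗ₜ y)) ∈
      LinearMap.range (triMul A d r s) := fun i x t y =>
    ⟨Half.scale (chi A d r s i) x ⊗ₜ (H.torusTwist i t ⊗ₜ (Half.x A d r s i * y)) +
      Half.deriv H i x ⊗ₜ (t ⊗ₜ y), by
      have he : ofHalfE A d r s (Half.x A d r s i) = mkGen A d r s (.e i) := Half.lift_x _ _ _
      rw [map_add, triMul_tmul, triMul_tmul, triMul_tmul, map_mul, he,
        ← mul_assoc (mkGen _ _ _ _ _), e_mul_ofHalfF H, add_mul, mul_assoc _ (mkGen _ _ _ _ _),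
        ← mul_assoc (mkGen _ _ _ _ _), e_mul_ofTorus H]
      simp only [mul_assoc]⟩
  have hadd : ∀ v w : Verma A d r s,
      mkGen A d r s g * triMul A d r s v ∈ LinearMap.range (triMul A d r s) →
      mkGen A d r s g * triMul A d r s w ∈ LinearMap.range (triMul A d r s) →
      mkGen A d r s g * triMul A d r s (v + w) ∈ LinearMap.range (triMul A d r s) := by
    intro v w hv hw
    rw [map_add, mul_add]
    exact add_mem hv hw
  induction v using TensorProduct.induction_on with
  | zero => simp
  | add v w hv hw => exact hadd v w hv hw
  | tmul x m =>
    induction m using TensorProduct.induction_on with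
    | zero => simp
    | add m n hm hn => rw [tmul_add]; exact hadd _ _ hm hn
    | tmul t y =>
      cases g with
      | e i => exact hE i x t y
      | f i => exact hF i x t y
      | w i => exact hT (.inl i) x t y
      | wInv i => exact hT' (.inl i) x t y
      | w' i => exact hT (.inr i) x t y
      | w'Inv i => exact hT' (.inr i) x t y

/-- The range is a left ideal containing `1`. -/
lemma triMul_surjective (H : Admissible A d r s) : Function.Surjective (triMul A d r s) := by
  have h1 : (1 : Kashiwara A d r s) ∈ LinearMap.range (triMul A d r s) :=
    ⟨1 ⊗ₜ (1 ⊗ₜ 1), by simp [triMul_tmul]⟩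
  have key : ∀ a : FreeAlgebra K (Gen I), ∀ b ∈ LinearMap.range (triMul A d r s),
      RingQuot.mkAlgHom K (Rel A d r s) a * b ∈ LinearMap.range (triMul A d r s) := by
    intro a
    induction a using FreeAlgebra.induction with
    | grade0 c =>
      intro b hb
      rw [AlgHom.commutes, ← Algebra.smul_def]
      exact Submodule.smul_mem _ c hb
    | grade1 g => rintro _ ⟨v, rfl⟩; exact mkGen_mul_mem_range_triMul H g v
    | mul a a' ha ha' => intro b hb; rw [map_mul, mul_assoc]; exact ha _ (ha' b hb)
    | add a a' ha ha' => intro b hb; rw [map_add, add_mul]; exact add_mem (ha b hb) (ha' b hb)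
  intro b
  obtain ⟨a, rfl⟩ := RingQuot.mkAlgHom_surjective K (Rel A d r s) b
  simpa using key a 1 h1

variable (A d r s) in
/-- The multiplication map of the three subalgebras. -/
def subMul : (Bminus A d r s ⊗[K] T A d r s) ⊗[K] Bplus A d r s →ₗ[K] Kashiwara A d r s :=
  LinearMap.mul' K _ ∘ₗ TensorProduct.map
    (LinearMap.mul' K _ ∘ₗ TensorProduct.map (Bminus A d r s).val.toLinearMap
      (T A d r s).val.toLinearMap) (Bplus A d r s).val.toLinearMap

/-- The presented algebras surject onto the three subalgebras. That these surjections are injective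
need not be known beforehand: injectivity of the composite `triMul`, together with surjectivity of
`q`, already forces `subMul` to be injective. -/
lemma exists_surjective_subMul_comp :
    ∃ q : Verma A d r s →ₗ[K] (Bminus A d r s ⊗[K] T A d r s) ⊗[K] Bplus A d r s,
      Function.Surjective q ∧ subMul A d r s ∘ₗ q = triMul A d r s := by
  have hF : ∀ x, ofHalfF A d r s x ∈ Bminus A d r s := fun x => by
    rw [← range_ofHalfF]; exact ⟨x, rfl⟩
  have hE : ∀ x, ofHalfE A d r s x ∈ Bplus A d r s := fun x => by
    rw [← range_ofHalfE]; exact ⟨x, rfl⟩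
  have hT : ∀ x, ofTorus A d r s x ∈ T A d r s := fun x => by
    rw [← range_ofTorus]; exact ⟨x, rfl⟩
  let πF := ((ofHalfF A d r s).codRestrict _ hF).toLinearMap
  let πE := ((ofHalfE A d r s).codRestrict _ hE).toLinearMap
  let πT := ((ofTorus A d r s).codRestrict _ hT).toLinearMap
  have sF : Function.Surjective πF := by
    rintro ⟨y, hy⟩
    rw [← range_ofHalfF] at hy
    obtain ⟨x, rfl⟩ := hy
    exact ⟨x, rfl⟩
  have sE : Function.Surjective πE := by
    rintro ⟨y, hy⟩
    rw [← range_ofHalfE] at hy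
    obtain ⟨x, rfl⟩ := hy
    exact ⟨x, rfl⟩
  have sT : Function.Surjective πT := by
    rintro ⟨y, hy⟩
    rw [← range_ofTorus] at hy
    obtain ⟨x, rfl⟩ := hy
    exact ⟨x, rfl⟩
  refine ⟨TensorProduct.map (TensorProduct.map πF πT) πE ∘ₗ
    (TensorProduct.assoc K _ _ _).symm.toLinearMap, ?_, ?_⟩
  · rw [LinearMap.coe_comp]
    exact (TensorProduct.map_surjective (TensorProduct.map_surjective sF sT) sE).comp
      (TensorProduct.assoc K _ _ _).symm.surjective
  · refine TensorProduct.ext (LinearMap.ext fun x => TensorProduct.ext' fun t y => ?_)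
    exact mul_assoc _ _ _

lemma subMul_bijective (H : Admissible A d r s) : Function.Bijective (subMul A d r s) := by
  obtain ⟨q, hq, hcomp⟩ := exists_surjective_subMul_comp (A := A) (d := d) (r := r) (s := s)
  have hcomp' : ∀ v, subMul A d r s (q v) = triMul A d r s v := DFunLike.congr_fun hcomp
  constructor
  · intro a b hab
    obtain ⟨v, rfl⟩ := hq a
    obtain ⟨w, rfl⟩ := hq b
    rw [hcomp', hcomp'] at hab
    rw [← rep_triMul H v, hab, rep_triMul H w]
  · intro b
    obtain ⟨v, rfl⟩ := triMul_surjective H b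
    exact ⟨q v, hcomp' v⟩

end Triangular

end TwoParamKashiwara

end

theorem proposition2p3 {K : Type*} [Field K] [IsAlgClosed K] [CharZero K]
    {I : Type*} [Fintype I] [LinearOrder I]
    (A : Matrix I I ℤ) (hA : TwoParamKashiwara.IsFiniteTypeCartan A)
    (d : I → ℕ) (hd : TwoParamKashiwara.IsSymmetrizer A d)
    (r s : K) (hr : r ≠ 0) (hs : s ≠ 0) (hrs : ∀ n : ℕ, 0 < n → (r * s⁻¹) ^ n ≠ 1) :
    ∃ μ : (TwoParamKashiwara.Bminus A d r s ⊗[K] TwoParamKashiwara.T A d r s) ⊗[K]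
        TwoParamKashiwara.Bplus A d r s ≃ₗ[K] TwoParamKashiwara.Kashiwara A d r s,
      ∀ (u₁ : TwoParamKashiwara.Bminus A d r s) (u₂ : TwoParamKashiwara.T A d r s)
        (u₃ : TwoParamKashiwara.Bplus A d r s),
        μ ((u₁ ⊗ₜ[K] u₂) ⊗ₜ[K] u₃) =
          (u₁ : TwoParamKashiwara.Kashiwara A d r s) * (u₂ : TwoParamKashiwara.Kashiwara A d r s) *
            (u₃ : TwoParamKashiwara.Kashiwara A d r s) := by
  have H := TwoParamKashiwara.admissible (r := r) (s := s) hd hA.offDiag hr hs hrs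
  exact ⟨LinearEquiv.ofBijective (TwoParamKashiwara.subMul A d r s)
    (TwoParamKashiwara.subMul_bijective H), fun _ _ _ => rfl⟩
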